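/- Let $\mathcal L$ be an algebraic signature with at least one constant symbol and let $\mathcal V$ be a variety of $\mathcal L$-algebras. For a set of equations $\Sigma$ and an equation $\varepsilon$, write $\Sigma\models_{\mathcal V}\varepsilon$ if every assignment into an algebra of $\mathcal V$ that satisfies $\Sigma$ satisfies $\varepsilon$; write $\Sigma\models_{\mathcal V}\Delta$ if $\Sigma\models_{\mathcal V}\varepsilon$ for all $\varepsilon\in\Delta$. Different letters $\overline x,\overline y,\overline z$ denote disjoint sets of variables, and $\Sigma(\overline x)$ means that the variables of $\Sigma$ lie in $\overline x$. Let $\mathbf F(\overline x)$ be the $\mathcal V$-free algebra on $\overline x$. For an algebra $\mathbf A$ let $\mathrm{KCon}\,\mathbf A$ be the join-semilattice of compact elements of the lattice $\mathrm{Con}\,\mathbf A$ of congruences of $\mathbf A$, ordered by inclusion; $\mathbf A$ is finitely presented in $\mathcal V$ if there is a surjective homomorphism $\mathbf F(\overline x)\to\mathbf A$ with $\overline x$ finite and compact kernel. For a homomorphism $h:\mathbf A\to\mathbf B$ and a congruence $\theta$ of $\mathbf B$ let $h^{-1}(\theta)=\{(a,a'):(h(a),h(a'))\in\theta\}$, and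 for a congruence $\psi$ of $\mathbf A$ let $h^*(\psi)$ be the congruence of $\mathbf B$ generated by $\{(h(a),h(a')):(a,a')\in\psi\}$. Suppose the following. 1. $\mathcal V$ has the amalgamation property: for all embeddings $i:\mathbf A\to\mathbf B$, $j:\mathbf A\to\mathbf C$ in $\mathcal V$ there are $\mathbf D\in\mathcal V$ and embeddings $h:\mathbf B\to\mathbf D$, $k:\mathbf C\to\mathbf D$ with $hi=kj$. 2. $\mathcal V$ admits right uniform deductive interpolation: for all finite $\overline x,\overline y$ and every finite set of equations $\Sigma(\overline x,\overline y)$ there is a finite set of equations $\Pi(\overline y)$ such that $\Sigma\models_{\mathcal V}\Pi$ and, for every equation $\varepsilon(\overline y,\overline z)$, $\Sigma\models_{\mathcal V}\varepsilon$ implies $\Pi\models_{\mathcal V}\varepsilon$. 3. $\mathcal V$ admits left uniform deductive interpolation: for all finite $\overline y,\overline z$ and every finite set of equations $\Delta(\overline y,\overline z)$ there is a finite set of equations $\Pi(\overline y)$ such that $\Pi\models_{\mathcal V}\Delta$ and, for every set of equations $\Sigma(\overline x,\overline y)$, $\Sigma\models_{\mathcal V}\Delta$ implies $\Sigma\models_{\mathcal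 V}\Pi$. 4. For every finitely presented $\mathbf A\in\mathcal V$, $\mathrm{KCon}\,\mathbf A$ is dually Brouwerian: for all $a,b\in\mathrm{KCon}\,\mathbf A$ there is $a-b\in\mathrm{KCon}\,\mathbf A$ such that, for all $c\in\mathrm{KCon}\,\mathbf A$, $a-b\le c$ if and only if $a\le b\vee c$. Let $T$ be the set of all first-order sentences true in all algebras of $\mathcal V$. Then $T$ has a model completion, that is, there is a theory $T^*$ such that $T$ and $T^*$ entail the same universal sentences ($T^*$ is a co-theory of $T$), every formula is equivalent over $T^*$ to an existential formula, and for every model $M$ of $T$ the theory $T^*$ together with the diagram of $M$ (all atomic and negated atomic sentences with constants for the elements of $M$ that are true in $M$) is complete (in particular satisfiable). Moreover, such a $T^*$ is given as follows. Fix a countably infinite set of variables, and let $J$ be the set of all tuples $j=(\Gamma,\Delta_1,\dots,\Delta_n,x)$ where $n\ge 0$, $\Gamma,\Delta_1,\dots,\Delta_n$ are finite sets of equations in these variables, and $x$ is one of these variables. For $j\in J$ let $\overline v$ be the set of variables occurring in $\Gamma,\Delta_1,\dots,\Delta_n$, let $\overline z=\overline v\setminus\{x\}$, and let $i:\mathbf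 F(\overline z)\to\mathbf F(\overline v)$ be the inclusion. Write $\theta_\Gamma,\theta_{\Delta_m}$ for the congruences on $\mathbf F(\overline v)$ generated by $\Gamma,\Delta_m$. Call finite sets of equations $\Sigma(\overline z),\Pi_1(\overline z),\dots,\Pi_n(\overline z)$ admissible for $j$ if $\Sigma$ generates the congruence $i^{-1}(\theta_\Gamma)$ on $\mathbf F(\overline z)$ and each $\Pi_m$ generates the congruence $\forall_i(\theta_{\Delta_m}-\theta_\Gamma)$ on $\mathbf F(\overline z)$, where for $\delta\in\mathrm{KCon}\,\mathbf F(\overline v)$ the congruence $\forall_i(\delta)$ is determined by: $\forall_i(\delta)\le\psi$ if and only if $\delta\le i^*(\psi)$, for all $\psi\in\mathrm{KCon}\,\mathbf F(\overline z)$. Then every $j\in J$ has admissible sets. For any choice, for each $j\in J$, of admissible sets, let $\psi_j$ be the universal closure of $$\Big(\bigwedge\Sigma\wedge\bigwedge_{m=1}^n\neg\bigwedge\Pi_m\Big)\to\exists x\Big(\bigwedge\Gamma\wedge\bigwedge_{m=1}^n\neg\bigwedge\Delta_m\Big).$$ Then $T^*=T\cup\{\psi_j: j\in J\}$ is a model completion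 of $T$, has quantifier elimination (every formula is equivalent over $T^*$ to a quantifier-free formula in the same free variables), and is a co-theory of $T$. -/

import Mathlib

universe u v w

namespace UnifInterp

open FirstOrder FirstOrder.Language

noncomputable section

/-! ### Congruences of algebras -/

/-- A congruence of an algebra: an equivalence relation compatible with all basic operations. -/
structure AlgCon (L : FirstOrder.Language.{u, v}) (A : Type w) [L.Structure A] extends Setoid A where
  map_fun : ∀ {n : ℕ} (f : L.Functions n) (a b : Fin n → A),
    (∀ i, toSetoid.r (a i) (b i)) → toSetoid.r (Structure.funMap f a) (Structure.funMap f b)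

namespace AlgCon

variable {L : FirstOrder.Language.{u, v}} {A : Type w} [L.Structure A]

theorem ext' {θ ψ : AlgCon L A} (h : ∀ a b, θ.r a b ↔ ψ.r a b) : θ = ψ := by
  cases θ with
  | mk s hs =>
    cases ψ with
    | mk t ht =>
      have : s = t := Setoid.ext h
      subst this
      rfl

/-- Congruences are ordered by inclusion. -/
instance : PartialOrder (AlgCon L A) where
  le θ ψ := ∀ a b, θ.r a b → ψ.r a b
  le_refl _ _ _ h := h
  le_trans _ _ _ h₁ h₂ a b h := h₂ a b (h₁ a b h)
  le_antisymm _ _ h₁ h₂ := ext' fun a b => ⟨h₁ a b, h₂ a b⟩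

/-- The infimum of a set of congruences is its intersection. -/
instance : InfSet (AlgCon L A) where
  sInf S :=
    { r := fun a b => ∀ θ ∈ S, θ.r a b
      iseqv :=
        ⟨fun a θ _ => θ.iseqv.refl a, fun h θ hθ => θ.iseqv.symm (h θ hθ),
          fun h₁ h₂ θ hθ => θ.iseqv.trans (h₁ θ hθ) (h₂ θ hθ)⟩
      map_fun := fun f a b h θ hθ => θ.map_fun f a b fun i => h i θ hθ }

theorem isGLB_sInf (S : Set (AlgCon L A)) : IsGLB S (sInf S) :=
  ⟨fun θ hθ _ _ h => h θ hθ, fun _ hψ a b h _ hθ => hψ hθ a b h⟩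

/-- The complete lattice `Con A` of congruences. -/
instance : CompleteLattice (AlgCon L A) := completeLatticeOfInf _ isGLB_sInf

/-- The congruence generated by a set of pairs. -/
def cg (S : Set (A × A)) : AlgCon L A := sInf {θ | ∀ p ∈ S, θ.r p.1 p.2}

/-- The inverse image lifting `h⁻¹ : Con B → Con A` of a homomorphism `h : A → B`. -/
def comap {B : Type*} [L.Structure B] (h : A →[L] B) (θ : AlgCon L B) : AlgCon L A where
  r a b := θ.r (h a) (h b)
  iseqv := ⟨fun _ => θ.iseqv.refl _, fun h' => θ.iseqv.symm h', fun h₁ h₂ => θ.iseqv.trans h₁ h₂⟩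
  map_fun f a b hab := by
    rw [Hom.map_fun, Hom.map_fun]
    exact θ.map_fun f _ _ hab

/-- The direct image lifting `h^* : Con A → Con B` of a homomorphism `h : A → B`. -/
def map {B : Type*} [L.Structure B] (h : A →[L] B) (ψ : AlgCon L A) : AlgCon L B :=
  cg {p | ∃ a a' : A, ψ.r a a' ∧ p = (h a, h a')}

/-- The kernel of a homomorphism. -/
def ker {B : Type*} [L.Structure B] (h : A →[L] B) : AlgCon L A where
  r a b := h a = h b
  iseqv := ⟨fun _ => rfl, fun h' => h'.symm, fun h₁ h₂ => h₁.trans h₂⟩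
  map_fun f a b hab := by
    rw [Hom.map_fun, Hom.map_fun]
    exact congrArg _ (funext hab)

instance [L.IsAlgebraic] (θ : AlgCon L A) : L.Prestructure θ.toSetoid where
  toStructure := inferInstance
  fun_equiv {_ f} x y h := θ.map_fun f x y h
  rel_equiv {_ r} := isEmptyElim r

end AlgCon

/-- The join-semilattice `KCon A` of compact congruences of `A`. -/
def KCon (L : FirstOrder.Language.{u, v}) (A : Type w) [L.Structure A] : Type w :=
  {θ : AlgCon L A // IsCompactElement θ}

theorem isCompactElement_sup {P : Type*} [CompleteLattice P] {a b : P}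
    (ha : IsCompactElement a) (hb : IsCompactElement b) : IsCompactElement (a ⊔ b) := by
  classical
  have h := CompleteLattice.isCompactElement_finsetSup (f := (id : P → P)) (s := {a, b})
    (by intro x hx; simp only [Finset.mem_insert, Finset.mem_singleton] at hx
        rcases hx with rfl | rfl <;> assumption)
  simpa using h

instance (L : FirstOrder.Language.{u, v}) (A : Type w) [L.Structure A] : SemilatticeSup (KCon L A) :=
  Subtype.semilatticeSup fun _ _ => isCompactElement_sup

/-- `d` is the residual `a - b` in a join-semilattice. -/
def IsResidual {P : Type*} [SemilatticeSup P] (a b d : P) : Prop :=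
  ∀ c : P, d ≤ c ↔ a ≤ b ⊔ c

/-- A join-semilattice is dually Brouwerian if all residuals `a - b` exist. -/
def DuallyBrouwerian (P : Type*) [SemilatticeSup P] : Prop :=
  ∀ a b : P, ∃ d : P, IsResidual a b d

/-! ### Equations, varieties, free algebras -/

/-- Equations with variables in `α`. -/
abbrev Equation (L : FirstOrder.Language.{u, v}) (α : Type w) := L.Term α × L.Term α

/-- The equation `e` holds in `A` under the assignment `f`. -/
def Holds {L : FirstOrder.Language.{u, v}} {α : Type*} {A : Type*} [L.Structure A] (f : α → A)
    (e : Equation L α) : Prop :=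
  e.1.realize f = e.2.realize f

/-- `A` lies in the variety axiomatized by the set `E` of identities. -/
def InVariety {L : FirstOrder.Language.{u, v}} (E : Set (Equation L ℕ)) (A : Type*) [L.Structure A] : Prop :=
  ∀ e ∈ E, ∀ f : ℕ → A, Holds f e

/-- Equational consequence `S ⊨ e` in the variety axiomatized by `E`. -/
def Conseq {L : FirstOrder.Language.{u, v}} (E : Set (Equation L ℕ)) {α : Type*} (S : Set (Equation L α))
    (e : Equation L α) : Prop :=
  ∀ (A : Type (max u v)) [L.Structure A], InVariety E A →
    ∀ f : α → A, (∀ s ∈ S, Holds f s) → Holds f e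

/-- The set of variables occurring in an equation. -/
def eqVars {L : FirstOrder.Language.{u, v}} (e : Equation L ℕ) : Finset ℕ := e.1.varFinset ∪ e.2.varFinset

/-- The term algebra. -/
instance termStructure {L : FirstOrder.Language.{u, v}} [L.IsAlgebraic] {α : Type*} :
    L.Structure (L.Term α) where
  funMap f ts := Term.func f ts
  RelMap r := isEmptyElim r

section Free

variable {L : FirstOrder.Language.{u, v}} [L.IsAlgebraic] (E : Set (Equation L ℕ))

/-- The congruence on the term algebra whose quotient is the free algebra of the variety:
two terms are identified when they are equal in all algebras of the variety. -/
def freeCon (α : Type w) : AlgCon L (L.Term α) where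
  r s t := Conseq E ∅ (s, t)
  iseqv :=
    ⟨fun _ _ _ _ _ _ => rfl, fun h A _ hA f hf => (h A hA f hf).symm,
      fun h₁ h₂ A _ hA f hf => (h₁ A hA f hf).trans (h₂ A hA f hf)⟩
  map_fun f a b h A _ hA g hg := by
    change Structure.funMap f _ = Structure.funMap f _
    exact congrArg _ (funext fun i => h i A hA g hg)

/-- The free algebra `F(α)` of the variety axiomatized by `E`. -/
def FreeAlg (α : Type w) : Type (max u w) := Quotient (freeCon E α).toSetoid

instance (α : Type w) : L.Structure (FreeAlg E α) :=
  inferInstanceAs (L.Structure (Quotient (freeCon E α).toSetoid))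

/-- The element of the free algebra given by a term. -/
def FreeAlg.mk {α : Type w} (t : L.Term α) : FreeAlg E α := Quotient.mk (freeCon E α).toSetoid t

/-- The homomorphism between free algebras induced by a map of variables. -/
def freeMap {α β : Type w} (g : α → β) : FreeAlg E α →[L] FreeAlg E β where
  toFun := Quotient.lift (fun t => FreeAlg.mk E (t.relabel g)) (by
    intro s t hst
    apply Quotient.sound
    intro A _ hA f _
    have := hst A hA (f ∘ g) (by simp)
    simpa [Holds, Term.realize_relabel] using this)
  map_fun' {n} f x := by
    have hx : ∃ y : Fin n → L.Term α, x = fun i => FreeAlg.mk E (y i) :=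
      ⟨fun i => (x i).out, funext fun i => (Quotient.out_eq (x i)).symm⟩
    obtain ⟨y, rfl⟩ := hx
    have h₁ := funMap_quotient_mk' (L := L) (freeCon E α).toSetoid f y
    have h₂ := funMap_quotient_mk' (L := L) (freeCon E β).toSetoid f (fun i => (y i).relabel g)
    refine Eq.trans (congrArg (Quotient.lift _ _) h₁) ?_
    exact h₂.symm
  map_rel' r := isEmptyElim r

/-- `A` is finitely presented in the variety axiomatized by `E`: it is the image of a finitely
generated free algebra under a homomorphism with compact kernel. -/
def FinitelyPresented (A : Type*) [L.Structure A] : Prop :=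
  ∃ (n : ℕ) (p : FreeAlg E (Fin n) →[L] A), Function.Surjective p ∧
    IsCompactElement (AlgCon.ker p)

end Free

/-! ### Properties of the variety -/

section Properties

variable {L : FirstOrder.Language.{u, v}} (E : Set (Equation L ℕ))

/-- The amalgamation property. -/
def AmalgamationProperty : Prop :=
  ∀ (A B C : Type (max u v)) [L.Structure A] [L.Structure B] [L.Structure C],
    InVariety E A → InVariety E B → InVariety E C →
    ∀ (i : A ↪[L] B) (j : A ↪[L] C),
      ∃ (D : Type (max u v)) (_ : L.Structure D), InVariety E D ∧
        ∃ (h : B ↪[L] D) (k : C ↪[L] D), ∀ a, h (i a) = k (j a)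

/-- Right uniform deductive interpolation. Variables are taken from `ℕ`, and `x`, `y`, `z` are
pairwise disjoint sets of variables. -/
def RightUniformInterpolation : Prop :=
  ∀ (x y : Finset ℕ), Disjoint x y → ∀ S : Finset (Equation L ℕ),
    (∀ e ∈ S, eqVars e ⊆ x ∪ y) →
    ∃ P : Finset (Equation L ℕ), (∀ e ∈ P, eqVars e ⊆ y) ∧
      (∀ e ∈ P, Conseq E S e) ∧
      ∀ z : Finset ℕ, Disjoint z (x ∪ y) → ∀ e : Equation L ℕ, eqVars e ⊆ y ∪ z →
        Conseq E S e → Conseq E P e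

/-- Left uniform deductive interpolation. Variables are taken from `ℕ`, and `x`, `y`, `z` are
pairwise disjoint sets of variables. -/
def LeftUniformInterpolation : Prop :=
  ∀ (y z : Finset ℕ), Disjoint y z → ∀ D : Finset (Equation L ℕ),
    (∀ e ∈ D, eqVars e ⊆ y ∪ z) →
    ∃ P : Finset (Equation L ℕ), (∀ e ∈ P, eqVars e ⊆ y) ∧
      (∀ e ∈ D, Conseq E P e) ∧
      ∀ x : Set ℕ, Disjoint x (y ∪ z : Finset ℕ) → ∀ S : Set (Equation L ℕ),
        (∀ e ∈ S, (eqVars e : Set ℕ) ⊆ x ∪ y) →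
        (∀ e ∈ D, Conseq E S e) → ∀ e ∈ P, Conseq E S e

/-- The first-order theory of the variety: all sentences true in all of its algebras. -/
def theoryOf : L.Theory :=
  {φ | ∀ (A : Type (max u v)) [L.Structure A], InVariety E A → A ⊨ φ}

end Properties

/-! ### Model completions -/

section ModelTheory

variable {L : FirstOrder.Language.{u, v}}

/-- Two theories are co-theories if they entail the same universal sentences. -/
def CoTheories (T T' : L.Theory) : Prop :=
  ∀ φ : L.Sentence, φ.IsUniversal → (T ⊨ᵇ φ ↔ T' ⊨ᵇ φ)

/-- Every formula is equivalent over `T` to an existential formula. -/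
def ModelComplete (T : L.Theory) : Prop :=
  ∀ (n : ℕ) (φ : L.Formula (Fin n)), ∃ ψ : L.Formula (Fin n), ψ.IsExistential ∧ T.Iff φ ψ

/-- Every formula is equivalent over `T` to a quantifier-free formula in the same variables. -/
def QuantifierElimination (T : L.Theory) : Prop :=
  ∀ (n : ℕ) (φ : L.Formula (Fin n)), ∃ ψ : L.Formula (Fin n), ψ.IsQF ∧ T.Iff φ ψ

/-- The diagram of `M`: all atomic and negated atomic sentences, with constants naming the
elements of `M`, that are true in `M`. -/
def diagram (M : Type w) [L.Structure M] : L[[M]].Theory :=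
  {φ | (φ.IsAtomic ∨ ∃ χ : L[[M]].Sentence, χ.IsAtomic ∧ φ = χ.not) ∧ M ⊨ φ}

/-- `T'` is a model companion of `T`. -/
def IsModelCompanion (T T' : L.Theory) : Prop :=
  CoTheories T T' ∧ ModelComplete T'

/-- `T'` is a model completion of `T`. -/
def IsModelCompletion (T T' : L.Theory) : Prop :=
  IsModelCompanion T T' ∧
    ∀ (M : Type (max u v)) [L.Structure M] [Nonempty M], M ⊨ T →
      ((L.lhomWithConstants M).onTheory T' ∪ diagram M).IsComplete

end ModelTheory

/-! ### The axioms of the model completion -/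

section Axioms

variable {L : FirstOrder.Language.{u, v}}

/-- The conjunction of a finite set of equations. -/
def conjEqs (G : Finset (Equation L ℕ)) : L.Formula ℕ :=
  Formula.iInf fun e : G => Term.equal e.1.1 e.1.2

/-- The formula `⋀ G ∧ ¬ ⋀ D₁ ∧ … ∧ ¬ ⋀ Dₙ`. -/
def phi (G : Finset (Equation L ℕ)) {n : ℕ} (D : Fin n → Finset (Equation L ℕ)) : L.Formula ℕ :=
  conjEqs G ⊓ Formula.iInf fun m : Fin n => (conjEqs (D m)).not

/-- The formula `∃ x, φ`. -/
def existsVar (x : ℕ) (φ : L.Formula ℕ) : L.Formula ℕ :=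
  Formula.iExs Unit
    (Formula.relabel (fun k : ℕ => if k = x then Sum.inr () else Sum.inl k) φ)

/-- The universal closure of a formula. -/
def allClosure (φ : L.Formula ℕ) : L.Sentence :=
  Formula.iAlls φ.freeVarFinset (Formula.relabel Sum.inr (φ.restrictFreeVar id))

/-- The data `(Γ, Δ₁, …, Δₙ, x)`: finite sets of equations and a variable. -/
structure Datum (L : FirstOrder.Language.{u, v}) where
  Γ : Finset (Equation L ℕ)
  n : ℕ
  Δ : Fin n → Finset (Equation L ℕ)
  x : ℕ

/-- The variables occurring in the equations of a datum. -/
def Datum.vars (j : Datum L) : Finset ℕ :=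
  j.Γ.biUnion eqVars ∪ Finset.univ.biUnion fun m => (j.Δ m).biUnion eqVars

/-- The variables of a datum other than `x`. -/
def Datum.params (j : Datum L) : Finset ℕ := j.vars.erase j.x

/-- The congruence `θ_G(y)` generated on `F(y)` by the equations of `G`, which are meant to have
all their variables in `y`. -/
def theta [L.IsAlgebraic] (E : Set (Equation L ℕ)) (y : Finset ℕ) (G : Finset (Equation L ℕ)) :
    AlgCon L (FreeAlg E y) :=
  AlgCon.cg {p | ∃ s t : L.Term y,
    (s.relabel Subtype.val, t.relabel Subtype.val) ∈ G ∧ p = (FreeAlg.mk E s, FreeAlg.mk E t)}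

/-- The homomorphism `F(z) → F(y)` induced by an inclusion `z ⊆ y`. -/
def incl [L.IsAlgebraic] (E : Set (Equation L ℕ)) {z y : Finset ℕ} (h : z ⊆ y) :
    FreeAlg E z →[L] FreeAlg E y :=
  freeMap E fun k => ⟨k.1, h k.2⟩

/-- `S` and `P₁, …, Pₙ` are sets of equations in the parameters `z` of the datum such that `S`
generates `i⁻¹(θ_Γ)` and `P_m` generates `∀ᵢ(θ_{Δ_m} - θ_Γ)`, where `i : F(z) → F(y)` is the
inclusion, `y` the set of all variables of the datum, the residual is taken in `KCon F(y)` and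
`∀ᵢ` is the left adjoint of `i^* : KCon F(z) → KCon F(y)`. -/
def Interpolants [L.IsAlgebraic] (E : Set (Equation L ℕ)) (j : Datum L)
    (S : Finset (Equation L ℕ)) (P : Fin j.n → Finset (Equation L ℕ)) : Prop :=
  let i := incl E (Finset.erase_subset j.x j.vars)
  (∀ e ∈ S, eqVars e ⊆ j.params) ∧ (∀ m, ∀ e ∈ P m, eqVars e ⊆ j.params) ∧
    theta E j.params S = AlgCon.comap i (theta E j.vars j.Γ) ∧
    ∀ m, ∃ g a d : KCon L (FreeAlg E j.vars),
      g.1 = theta E j.vars j.Γ ∧ a.1 = theta E j.vars (j.Δ m) ∧ IsResidual a g d ∧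
      ∀ ψ : KCon L (FreeAlg E j.params),
        theta E j.params (P m) ≤ ψ.1 ↔ d.1 ≤ AlgCon.map i ψ.1

/-- The sentence `∀ z (φ_{(S, P₁, …, Pₙ)} → ∃ x φ_{(Γ, Δ₁, …, Δₙ)})`. -/
def psi (j : Datum L) (S : Finset (Equation L ℕ)) (P : Fin j.n → Finset (Equation L ℕ)) :
    L.Sentence :=
  allClosure ((phi S P).imp (existsVar j.x (phi j.Γ j.Δ)))

/-- The theory of the variety together with all the sentences `psi j`. -/
def Tstar (E : Set (Equation L ℕ)) (S : Datum L → Finset (Equation L ℕ))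
    (P : (j : Datum L) → Fin j.n → Finset (Equation L ℕ)) : L.Theory :=
  theoryOf E ∪ Set.range fun j => psi j (S j) (P j)

end Axioms

end

end UnifInterp

/-!
The variety has a model completion because solvability of a finite system of equations and negated
equations in an extension is a quantifier-free condition on its parameters, and the axioms `psi j`
say exactly that whatever is solvable in an extension is already solved.

One direction (`EqInterpolants.sat_params`) is immediate: a solution of `Γ, ¬Δ₁, …, ¬Δₙ` forces the
parameters to satisfy the right interpolant of `Γ`, and to violate the left interpolant of each
residual `Δₘ - Γ`. For the converse (`EqInterpolants.exists_extension`) let `a` be a tuple of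
parameters in `M` satisfying this condition. The algebra presented by `Γ` together with all
equations true of `a` violates each `Δₘ`, by the defining properties of the residual and of the left
interpolant and by compactness. It can be amalgamated with `M` over the subalgebra generated by `a`
provided that no new equations about `a` follow, which is an instance of the congruence extension
property. This property is not assumed. It is derived in `holds_of_conseq_union_typeOf`: if `Γ`
and the type of `a` entail `s = t`, take a fresh variable `w` and the residual of `s = w` by `Γ`. Its
left interpolant `Π`, free of the eliminated variable, follows from `w = t` and the type of `a`, and
also from `w = s` alone. Hence it holds in a subdirect product of `M`, with `w` read as `t`, and of
the algebra presented by `Γ`, with `w` read as `s`. Amalgamating this product with the algebra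
presented by `Γ` makes both `Γ` and `Π`, hence `s = w`, true, and the projection to `M` gives `s = t`.

By compactness all data over `M` can be solved in one extension, and the union of a chain of such
extensions is a model of `Tstar` (`exists_extension_closed`). So `Tstar` is a co-theory of the theory
of the variety. Disjunctive normal forms reduce quantifier elimination to a single existential
quantifier in front of a clause, where the axioms apply (`exists_isQF_existsVar`). Completeness of
`Tstar` over a diagram follows, as diagrams decide quantifier-free sentences.

The hypotheses on congruences of free algebras enter through `theta_r_iff`, which identifies the
congruence generated by a finite set of equations with entailment.
-/

namespace UnifInterp

open FirstOrder FirstOrder.Language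

noncomputable section

/-! ### Equations under assignments -/

section Holds

variable {L : FirstOrder.Language.{u, v}}

theorem realize_congr_vars {A : Type*} [L.Structure A] (t : L.Term ℕ) {f g : ℕ → A}
    (h : ∀ i ∈ t.varFinset, f i = g i) : t.realize f = t.realize g := by
  induction t with
  | var i => exact h i (by simp [Term.varFinset])
  | func F ts ih =>
    simp only [Term.realize]
    congr 1
    funext i
    exact ih i fun k hk => h k (by simpa [Term.varFinset] using ⟨i, hk⟩)

theorem holds_congr_vars {A : Type*} [L.Structure A] {e : Equation L ℕ} {f g : ℕ → A}
    (h : ∀ i ∈ eqVars e, f i = g i) : Holds f e ↔ Holds g e := by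
  unfold Holds
  rw [realize_congr_vars e.1 fun i hi => h i (Finset.mem_union_left _ hi),
    realize_congr_vars e.2 fun i hi => h i (Finset.mem_union_right _ hi)]

theorem holds_embedding {α A B : Type*} [L.Structure A] [L.Structure B] (h : A ↪[L] B)
    {f : α → A} {e : Equation L α} : Holds (h ∘ f) e ↔ Holds f e := by
  unfold Holds
  rw [HomClass.realize_term, HomClass.realize_term, h.injective.eq_iff]

theorem holds_relabel {α β A : Type*} [L.Structure A] {g : α → β} {f : β → A} {s t : L.Term α} :
    Holds f (s.relabel g, t.relabel g) ↔ Holds (f ∘ g) (s, t) := by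
  simp [Holds, Term.realize_relabel]

theorem InVariety.of_embedding {E : Set (Equation L ℕ)} {A B : Type*} [L.Structure A]
    [L.Structure B] (hB : InVariety E B) (h : A ↪[L] B) : InVariety E A := fun e he _ =>
  (holds_embedding h).1 (hB e he _)

theorem exists_relabel_eq (t : L.Term ℕ) (y : Finset ℕ) (h : t.varFinset ⊆ y) :
    ∃ s : L.Term y, s.relabel Subtype.val = t := by
  induction t with
  | var i => exact ⟨Term.var ⟨i, h (by simp [Term.varFinset])⟩, rfl⟩
  | func F ts ih =>
    have : ∀ i, ∃ s : L.Term y, s.relabel Subtype.val = ts i := fun i =>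
      ih i fun k hk => h (by simpa [Term.varFinset] using ⟨i, hk⟩)
    choose s hs using this
    exact ⟨Term.func F s, by simp [Term.relabel, hs]⟩

theorem varFinset_relabel_subset {y : Finset ℕ} (s : L.Term y) :
    (s.relabel Subtype.val : L.Term ℕ).varFinset ⊆ y := by
  induction s with
  | var i => simp [Term.relabel, Term.varFinset]
  | func F ts ih =>
    intro k hk
    simp only [Term.relabel, Term.varFinset, Finset.mem_biUnion, Finset.mem_univ, true_and] at hk
    obtain ⟨i, hi⟩ := hk
    exact ih i hi

theorem eqVars_relabel_subset {y : Finset ℕ} (s t : L.Term y) :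
    eqVars (L := L) (s.relabel Subtype.val, t.relabel Subtype.val) ⊆ y :=
  Finset.union_subset (varFinset_relabel_subset s) (varFinset_relabel_subset t)

theorem subst_var_eq {β : Type*} (t : L.Term β) : t.subst Term.var = t := by
  induction t with
  | var i => rfl
  | func f ts ih => simp [Term.subst, ih]

/-- An injective homomorphism of algebras is an embedding, as there are no relations. -/
def embeddingOfInjective [L.IsAlgebraic] {A B : Type*} [L.Structure A] [L.Structure B]
    (h : A →[L] B) (hi : Function.Injective h) : A ↪[L] B where
  toFun := h
  inj' := hi
  map_fun' := h.map_fun'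
  map_rel' r := isEmptyElim r

end Holds

/-! ### Quotients of term algebras -/

section TermQuot

variable {L : FirstOrder.Language.{u, v}} [L.IsAlgebraic] {α : Type w}

/-- The quotient of the term algebra on `α` by a congruence, lifted to a universe large enough to
host all algebras over which entailments between equations in `α` are tested. -/
def TermQuot (θ : AlgCon L (L.Term α)) : Type (max u v w) := ULift.{v} (Quotient θ.toSetoid)

instance (θ : AlgCon L (L.Term α)) : L.Structure (TermQuot θ) where
  funMap f x := ⟨Structure.funMap f fun i => (x i).down⟩
  RelMap r := isEmptyElim r

namespace TermQuot

variable (θ : AlgCon L (L.Term α))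

/-- The class of a term. -/
def mk (t : L.Term α) : TermQuot θ := ⟨Quotient.mk θ.toSetoid t⟩

variable {θ}

theorem mk_eq_mk {s t : L.Term α} : mk θ s = mk θ t ↔ θ.r s t := by
  exact ULift.up_injective.eq_iff.trans (Quotient.eq (r := θ.toSetoid))

theorem exists_mk (a : TermQuot θ) : ∃ t, mk θ t = a := by
  obtain ⟨a⟩ := a
  obtain ⟨t, rfl⟩ := Quotient.exists_rep a
  exact ⟨t, rfl⟩

theorem funMap_mk {n : ℕ} (f : L.Functions n) (ts : Fin n → L.Term α) :
    Structure.funMap f (fun i => mk θ (ts i)) = mk θ (Term.func f ts) :=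
  congrArg ULift.up (funMap_quotient_mk' (L := L) θ.toSetoid f ts)

theorem realize_mk {β : Type*} (t : L.Term β) (σ : β → L.Term α) :
    t.realize (fun i => mk θ (σ i)) = mk θ (t.subst σ) := by
  induction t with
  | var i => rfl
  | func f ts ih => simp only [Term.realize, ih, funMap_mk, Term.subst]

variable (θ) in
/-- The generic assignment, sending a variable to its class. -/
def gen (i : α) : TermQuot θ := mk θ (Term.var i)

theorem realize_gen (t : L.Term α) : t.realize (gen θ) = mk θ t := by
  have := realize_mk (θ := θ) t Term.var
  rwa [subst_var_eq] at this

theorem holds_gen {e : Equation L α} : Holds (gen θ) e ↔ θ.r e.1 e.2 := by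
  unfold Holds
  rw [realize_gen, realize_gen, mk_eq_mk]

/-- A quotient of the term algebra lies in the variety if it satisfies all substitution instances
of the defining identities. -/
theorem inVariety {E : Set (Equation L ℕ)}
    (h : ∀ e ∈ E, ∀ σ : ℕ → L.Term α, θ.r (e.1.subst σ) (e.2.subst σ)) :
    InVariety E (TermQuot θ) := by
  intro e he f
  choose σ hσ using fun i => exists_mk (f i)
  obtain rfl : (fun i => mk θ (σ i)) = f := funext hσ
  unfold Holds
  rw [realize_mk, realize_mk, mk_eq_mk]
  exact h e he σ

/-- The homomorphism from the quotient induced by an assignment satisfying the congruence. -/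
def lift {A : Type*} [L.Structure A] (f : α → A)
    (h : ∀ s t, θ.r s t → s.realize f = t.realize f) : TermQuot θ →[L] A where
  toFun a := Quotient.lift (fun t : L.Term α => t.realize f) (fun s t hst => h s t hst) a.down
  map_fun' {n} F x := by
    choose ts hts using fun i => exists_mk (x i)
    obtain rfl : (fun i => mk θ (ts i)) = x := funext hts
    rw [funMap_mk]
    rfl
  map_rel' r := isEmptyElim r

theorem lift_injective {A : Type*} [L.Structure A] (f : α → A)
    (h : ∀ s t, θ.r s t → s.realize f = t.realize f)
    (h' : ∀ s t, s.realize f = t.realize f → θ.r s t) : Function.Injective (lift f h) := by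
  intro a b hab
  obtain ⟨s, rfl⟩ := exists_mk a
  obtain ⟨t, rfl⟩ := exists_mk b
  exact mk_eq_mk.2 (h' s t hab)

end TermQuot

/-- The congruence of term pairs equal under an assignment. -/
def kerRealize {A : Type*} [L.Structure A] (f : α → A) : AlgCon L (L.Term α) where
  r s t := s.realize f = t.realize f
  iseqv := ⟨fun _ => rfl, fun h => h.symm, fun h₁ h₂ => h₁.trans h₂⟩
  map_fun F a b hab := by
    change Structure.funMap F _ = Structure.funMap F _
    exact congrArg _ (funext hab)

theorem kerRealize_subst {E : Set (Equation L ℕ)} {A : Type*} [L.Structure A]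
    (hA : InVariety E A) (f : α → A) {e : Equation L ℕ} (he : e ∈ E) (σ : ℕ → L.Term α) :
    (kerRealize f).r (e.1.subst σ) (e.2.subst σ) := by
  change (e.1.subst σ).realize f = (e.2.subst σ).realize f
  rw [Term.realize_subst, Term.realize_subst]
  exact hA e he _

end TermQuot

/-! ### Entailment and its compactness -/

section Entails

variable {L : FirstOrder.Language.{u, v}} (E : Set (Equation L ℕ)) {α : Type w}

/-- Equational consequence tested on the algebras of a universe that contains the algebras
presented by generators in `α : Type w`. For `w = 0` this is `Conseq`. -/
def Entails (S : Set (Equation L α)) (e : Equation L α) : Prop :=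
  ∀ (A : Type (max u v w)) [L.Structure A], InVariety E A →
    ∀ f : α → A, (∀ s ∈ S, Holds f s) → Holds f e

variable {E}

theorem Entails.mono {S T : Set (Equation L α)} {e : Equation L α} (h : Entails E S e)
    (hST : S ⊆ T) : Entails E T e := fun A _ hA f hf => h A hA f fun s hs => hf s (hST hs)

variable [L.IsAlgebraic] (E)

/-- The congruence on the term algebra of equations entailed by `S`. -/
def entailsCon (S : Set (Equation L α)) : AlgCon L (L.Term α) where
  r s t := Entails E S (s, t)
  iseqv :=
    ⟨fun _ _ _ _ _ _ => rfl, fun h A _ hA f hf => (h A hA f hf).symm,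
      fun h₁ h₂ A _ hA f hf => (h₁ A hA f hf).trans (h₂ A hA f hf)⟩
  map_fun f a b h A _ hA g hg := by
    change Structure.funMap f _ = Structure.funMap f _
    exact congrArg _ (funext fun i => h i A hA g hg)

theorem entails_subst (S : Set (Equation L α)) {e : Equation L ℕ} (he : e ∈ E)
    (σ : ℕ → L.Term α) : Entails E S (e.1.subst σ, e.2.subst σ) := by
  intro A _ hA f _
  exact kerRealize_subst hA f he σ

/-- The algebra presented by generators `α` and relations `S`. -/
abbrev Presented (S : Set (Equation L α)) : Type (max u v w) := TermQuot (entailsCon E S)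

theorem presented_inVariety (S : Set (Equation L α)) : InVariety E (Presented E S) :=
  TermQuot.inVariety fun _ he σ => entails_subst E S he σ

variable {E}

theorem holds_gen_presented {S : Set (Equation L α)} {e : Equation L α} :
    Holds (TermQuot.gen (entailsCon E S)) e ↔ Entails E S e := TermQuot.holds_gen

theorem holds_gen_of_mem {S : Set (Equation L α)} {e : Equation L α} (he : e ∈ S) :
    Holds (TermQuot.gen (entailsCon E S)) e :=
  holds_gen_presented.2 fun _ _ _ _ hf => hf e he

variable (E) in
/-- The congruence of equations entailed by a finite part of `S`. -/
def finEntailsCon (S : Set (Equation L α)) : AlgCon L (L.Term α) where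
  r s t := ∃ T : Finset (Equation L α), ↑T ⊆ S ∧ Entails E (T : Set (Equation L α)) (s, t)
  iseqv := by
    classical
    refine ⟨fun s => ⟨∅, by simp, (entailsCon E _).iseqv.refl s⟩, ?_, ?_⟩
    · rintro s t ⟨T, hT, h⟩
      exact ⟨T, hT, (entailsCon E _).iseqv.symm h⟩
    · rintro s t r ⟨T, hT, h⟩ ⟨T', hT', h'⟩
      refine ⟨T ∪ T', by simp [hT, hT'], ?_⟩
      exact (entailsCon E _).iseqv.trans (h.mono (by simp)) (h'.mono (by simp))
  map_fun f a b h := by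
    classical
    choose T hT h using h
    refine ⟨Finset.univ.biUnion T, by simpa using hT, ?_⟩
    refine (entailsCon E _).map_fun f a b fun i => (h i).mono ?_
    intro e he
    simp only [Finset.coe_biUnion, Set.mem_iUnion]
    exact ⟨i, by simp, he⟩

theorem Entails.exists_finset {S : Set (Equation L α)} {e : Equation L α} (h : Entails E S e) :
    ∃ T : Finset (Equation L α), ↑T ⊆ S ∧ Entails E (T : Set (Equation L α)) e := by
  have hV : InVariety E (TermQuot (finEntailsCon E S)) :=
    TermQuot.inVariety fun e he σ => ⟨∅, by simp, entails_subst E _ he σ⟩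
  refine TermQuot.holds_gen.1 (h _ hV (TermQuot.gen (finEntailsCon E S)) fun s hs => ?_)
  refine TermQuot.holds_gen.2 ⟨{s}, by simpa using hs, ?_⟩
  intro A _ _ f hf
  exact hf s (by simp)

theorem Entails.exists_finset_forall {S : Set (Equation L α)} {D : Finset (Equation L α)}
    (h : ∀ e ∈ D, Entails E S e) :
    ∃ T : Finset (Equation L α), ↑T ⊆ S ∧ ∀ e ∈ D, Entails E (T : Set (Equation L α)) e := by
  classical
  choose! T hT hT' using fun e he => (h e he).exists_finset
  refine ⟨D.biUnion T, ?_, fun e he => (hT' e he).mono ?_⟩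
  · intro e he
    simp only [Finset.coe_biUnion, Set.mem_iUnion] at he
    obtain ⟨d, hd, he⟩ := he
    exact hT d hd he
  · exact_mod_cast Finset.subset_biUnion_of_mem T he

end Entails

/-! ### Amalgamation over a set of variables -/

section Amalgam

variable {L : FirstOrder.Language.{u, v}} [L.IsAlgebraic] {E : Set (Equation L ℕ)}

/-- If two assignments into algebras of the variety satisfy the same equations in the variables
`z`, the algebras can be amalgamated so that the two assignments agree on `z`. -/
theorem AmalgamationProperty.amalgamate (hAP : AmalgamationProperty E) {B C : Type (max u v)}
    [L.Structure B] [L.Structure C] (hB : InVariety E B) (hC : InVariety E C) (b : ℕ → B)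
    (c : ℕ → C) (z : Finset ℕ) (h : ∀ e : Equation L ℕ, eqVars e ⊆ z → (Holds b e ↔ Holds c e)) :
    ∃ (D : Type (max u v)) (_ : L.Structure D), InVariety E D ∧
      ∃ (i : B ↪[L] D) (k : C ↪[L] D), ∀ n ∈ z, i (b n) = k (c n) := by
  let b' : z → B := fun n => b n
  let c' : z → C := fun n => c n
  let θ := kerRealize (L := L) b'
  have hbc : ∀ s t : L.Term z, s.realize c' = t.realize c' ↔ s.realize b' = t.realize b' := by
    intro s t
    have := h _ (eqVars_relabel_subset s t)
    rw [holds_relabel, holds_relabel] at this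
    exact this.symm
  let ib : TermQuot θ ↪[L] B := embeddingOfInjective (TermQuot.lift b' fun s t hst => hst)
    (TermQuot.lift_injective _ _ fun s t hst => hst)
  let ic : TermQuot θ ↪[L] C := embeddingOfInjective
    (TermQuot.lift c' fun s t hst => (hbc s t).2 hst)
    (TermQuot.lift_injective _ _ fun s t hst => (hbc s t).1 hst)
  obtain ⟨D, hDs, hD, i, k, hik⟩ := hAP (TermQuot θ) B C (hB.of_embedding ib) hB hC ib ic
  exact ⟨D, hDs, hD, i, k, fun n hn => hik (TermQuot.gen θ ⟨n, hn⟩)⟩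

end Amalgam

/-! ### Extending a solution of the parameters -/

section Extension

variable {L : FirstOrder.Language.{u, v}} (E : Set (Equation L ℕ))

/-- Residuals expressed by equations: for finite sets `G`, `D` of equations in the variables `y`
there is a weakest finite set `R` of equations in `y` which together with `G` entails `D`. -/
def HasEqResiduals : Prop :=
  ∀ (y : Finset ℕ) (G D : Finset (Equation L ℕ)), (∀ e ∈ G, eqVars e ⊆ y) →
    (∀ e ∈ D, eqVars e ⊆ y) → ∃ R : Finset (Equation L ℕ), (∀ e ∈ R, eqVars e ⊆ y) ∧
      ∀ C : Finset (Equation L ℕ), (∀ e ∈ C, eqVars e ⊆ y) →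
        ((∀ e ∈ R, Conseq E C e) ↔ ∀ e ∈ D, Conseq E (G ∪ C : Set (Equation L ℕ)) e)

variable {E}

theorem conseq_of_mem {α : Type*} {S : Set (Equation L α)} {e : Equation L α} (h : e ∈ S) :
    Conseq E S e := fun _ _ _ _ hf => hf e h

theorem Conseq.mono {α : Type*} {S T : Set (Equation L α)} {e : Equation L α}
    (h : Conseq E S e) (hST : S ⊆ T) : Conseq E T e :=
  fun A _ hA f hf => h A hA f fun s hs => hf s (hST hs)

theorem Conseq.trans {α : Type*} {S T : Set (Equation L α)} {e : Equation L α}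
    (h : Conseq E T e) (hST : ∀ s ∈ T, Conseq E S s) : Conseq E S e :=
  fun A _ hA f hf => h A hA f fun s hs => hST s hs A hA f hf

/-- The assignment `f` satisfies all equations of `G` and, for each `m`, violates some equation of
`D m`. -/
def Sat {A : Type*} [L.Structure A] (f : ℕ → A) (G : Finset (Equation L ℕ)) {n : ℕ}
    (D : Fin n → Finset (Equation L ℕ)) : Prop :=
  (∀ e ∈ G, Holds f e) ∧ ∀ m, ¬ ∀ e ∈ D m, Holds f e

theorem sat_embedding {A B : Type*} [L.Structure A] [L.Structure B] (h : A ↪[L] B) {f : ℕ → A}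
    {G : Finset (Equation L ℕ)} {n : ℕ} {D : Fin n → Finset (Equation L ℕ)} :
    Sat (h ∘ f) G D ↔ Sat f G D := by
  simp only [Sat, holds_embedding]

theorem sat_congr {A : Type*} [L.Structure A] {f g : ℕ → A}
    {G : Finset (Equation L ℕ)} {n : ℕ} {D : Fin n → Finset (Equation L ℕ)} {y : Finset ℕ}
    (hG : ∀ e ∈ G, eqVars e ⊆ y) (hD : ∀ m, ∀ e ∈ D m, eqVars e ⊆ y)
    (hfg : ∀ i ∈ y, f i = g i) : Sat f G D ↔ Sat g G D := by
  have h : ∀ e : Equation L ℕ, eqVars e ⊆ y → (Holds f e ↔ Holds g e) := fun e he =>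
    holds_congr_vars fun i hi => hfg i (he hi)
  exact and_congr (forall₂_congr fun e he => h e (hG e he))
    (forall_congr' fun m => not_congr (forall₂_congr fun e he => h e (hD m e he)))

theorem Datum.eqVars_Γ (j : Datum L) {e : Equation L ℕ} (he : e ∈ j.Γ) : eqVars e ⊆ j.vars :=
  (Finset.subset_biUnion_of_mem eqVars he).trans Finset.subset_union_left

theorem Datum.eqVars_Δ (j : Datum L) (m : Fin j.n) {e : Equation L ℕ} (he : e ∈ j.Δ m) :
    eqVars e ⊆ j.vars :=
  ((Finset.subset_biUnion_of_mem eqVars he).trans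
    (Finset.subset_biUnion_of_mem (fun m => (j.Δ m).biUnion eqVars) (Finset.mem_univ m))).trans
      Finset.subset_union_right

variable (E) in
/-- The equational form of `Interpolants`. -/
structure EqInterpolants (j : Datum L) (S : Finset (Equation L ℕ))
    (P : Fin j.n → Finset (Equation L ℕ)) : Prop where
  vars_left : ∀ e ∈ S, eqVars e ⊆ j.params
  vars_right : ∀ m, ∀ e ∈ P m, eqVars e ⊆ j.params
  conseq_iff : ∀ e, eqVars e ⊆ j.params →
    (Conseq E (S : Set (Equation L ℕ)) e ↔ Conseq E (j.Γ : Set (Equation L ℕ)) e)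
  forall_conseq_iff : ∀ m, ∀ C : Finset (Equation L ℕ), (∀ e ∈ C, eqVars e ⊆ j.params) →
    ((∀ e ∈ P m, Conseq E (C : Set (Equation L ℕ)) e) ↔
      ∀ e ∈ j.Δ m, Conseq E (j.Γ ∪ C : Set (Equation L ℕ)) e)

/-- A solution of the datum forces its parameters to satisfy the interpolants. -/
theorem EqInterpolants.sat_params {j : Datum L} {S : Finset (Equation L ℕ)}
    {P : Fin j.n → Finset (Equation L ℕ)} (h : EqInterpolants E j S P) {M : Type (max u v)}
    [L.Structure M] (hM : InVariety E M) {a : ℕ → M} (ha : Sat a j.Γ j.Δ) : Sat a S P := by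
  refine ⟨fun e he => ?_, fun m hP => ha.2 m fun e he => ?_⟩
  · exact (h.conseq_iff e (h.vars_left e he)).1 (conseq_of_mem he) M hM a ha.1
  · refine (h.forall_conseq_iff m (P m) (h.vars_right m)).1 (fun e he => conseq_of_mem he) e he
      M hM a ?_
    rintro d (hd | hd)
    · exact ha.1 d hd
    · exact hP d hd

/-- The equations in the variables `z` that hold under the assignment `a`. -/
def typeOf {A : Type*} [L.Structure A] (a : ℕ → A) (z : Finset ℕ) : Set (Equation L ℕ) :=
  {e | eqVars e ⊆ z ∧ Holds a e}

variable [L.IsAlgebraic]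

theorem Conseq.exists_finset_forall {S : Set (Equation L ℕ)} {D : Finset (Equation L ℕ)}
    (h : ∀ e ∈ D, Conseq E S e) :
    ∃ T : Finset (Equation L ℕ), ↑T ⊆ S ∧ ∀ e ∈ D, Conseq E (T : Set (Equation L ℕ)) e :=
  Entails.exists_finset_forall h

/-- The congruence on the term algebra of pairs of terms equal under both assignments. -/
def kerRealizeInf {α : Type*} {A B : Type*} [L.Structure A] [L.Structure B] (f : α → A)
    (g : α → B) : AlgCon L (L.Term α) where
  r s t := s.realize f = t.realize f ∧ s.realize g = t.realize g
  iseqv := ⟨fun _ => ⟨rfl, rfl⟩, fun h => ⟨h.1.symm, h.2.symm⟩,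
    fun h₁ h₂ => ⟨h₁.1.trans h₂.1, h₁.2.trans h₂.2⟩⟩
  map_fun F a b hab :=
    ⟨(kerRealize f).map_fun F a b fun i => (hab i).1,
      (kerRealize g).map_fun F a b fun i => (hab i).2⟩

theorem HasEqResiduals.exists_forall_set (hRes : HasEqResiduals E) {y : Finset ℕ}
    {G D : Finset (Equation L ℕ)} (hG : ∀ e ∈ G, eqVars e ⊆ y) (hD : ∀ e ∈ D, eqVars e ⊆ y) :
    ∃ R : Finset (Equation L ℕ), (∀ e ∈ R, eqVars e ⊆ y) ∧
      (∀ e ∈ D, Conseq E (G ∪ R : Set (Equation L ℕ)) e) ∧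
      ∀ C : Set (Equation L ℕ), (∀ e ∈ C, eqVars e ⊆ y) →
        (∀ e ∈ D, Conseq E (G ∪ C) e) → ∀ e ∈ R, Conseq E C e := by
  classical
  obtain ⟨R, hRy, hR⟩ := hRes y G D hG hD
  refine ⟨R, hRy, (hR R hRy).1 fun e he => conseq_of_mem he, fun C hC h => ?_⟩
  obtain ⟨T, hT, hTD⟩ := Conseq.exists_finset_forall h
  have hsub : ((T.filter (· ∈ C) : Finset (Equation L ℕ)) : Set (Equation L ℕ)) ⊆ C :=
    fun e he => (Finset.mem_filter.1 he).2
  have := (hR (T.filter (· ∈ C)) fun e he => hC e (hsub he)).2 fun e he =>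
    (hTD e he).mono fun s hs => by
      rcases hT hs with h | h
      · exact Or.inl h
      · exact Or.inr (Finset.mem_filter.2 ⟨hs, h⟩)
  exact fun e he => (this e he).mono hsub

/-- Adding the equations `Γ` to the type of a tuple `a` yields no new equations about `a`,
provided that `a` satisfies all consequences of `Γ` in its variables. This is where the congruence
extension property enters: it is forced by amalgamation together with left uniform interpolation
and the existence of residuals. -/
theorem holds_of_conseq_union_typeOf (hAP : AmalgamationProperty E)
    (hLeft : LeftUniformInterpolation E) (hRes : HasEqResiduals E) {y : Finset ℕ} (x : ℕ)
    {G : Finset (Equation L ℕ)} (hG : ∀ e ∈ G, eqVars e ⊆ y) {M : Type (max u v)} [L.Structure M]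
    (hM : InVariety E M) (a : ℕ → M)
    (ha : ∀ e, eqVars e ⊆ y.erase x → Conseq E (G : Set (Equation L ℕ)) e → Holds a e)
    {e : Equation L ℕ} (he : eqVars e ⊆ y.erase x)
    (h : Conseq E (G ∪ typeOf a (y.erase x)) e) : Holds a e := by
  classical
  obtain ⟨s, t⟩ := e
  set z := y.erase x with hz
  obtain ⟨w, hw⟩ := Infinite.exists_notMem_finset (insert x y)
  simp only [Finset.mem_insert, not_or] at hw
  have hwz : w ∉ z := fun h' => hw.2 (Finset.mem_of_mem_erase h')
  have hs : s.varFinset ⊆ z := Finset.union_subset_left he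
  have ht : t.varFinset ⊆ z := Finset.union_subset_right he
  -- `ε` is the equation `s = w`, and `R` its residual by `G` in the variables `y ∪ {w}`.
  let ε : Equation L ℕ := (s, Term.var w)
  have hε : eqVars ε ⊆ insert w z := by
    refine Finset.union_subset (hs.trans (Finset.subset_insert _ _)) ?_
    exact Finset.singleton_subset_iff.2 (Finset.mem_insert_self w z)
  have hzy : insert w z ⊆ insert w y := Finset.insert_subset_insert _ (Finset.erase_subset _ _)
  obtain ⟨R, hRy, hR, hR'⟩ := hRes.exists_forall_set (y := insert w y) (G := G) (D := {ε})
    (fun e he => (hG e he).trans (Finset.subset_insert _ _))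
    (fun e he => Finset.mem_singleton.1 he ▸ hε.trans hzy)
  obtain ⟨P, hPz, hP, hP'⟩ := hLeft (insert w z) {x}
    (by simp [hz, Ne.symm hw.1]) R (fun e he => (hRy e he).trans (by
      intro k hk
      simp only [Finset.mem_insert] at hk
      by_cases hkx : k = x
      · simp [hkx]
      · rcases hk with rfl | hk
        · simp
        · simp [hz, hkx, hk]))
  -- The residual, and with it its interpolant, follows from the type of `a` with `w = t` ...
  let β₁ : Set (Equation L ℕ) := insert (Term.var w, t) (typeOf a z)
  let β₂ : Set (Equation L ℕ) := {(Term.var w, s)}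
  have hvar : ∀ r : L.Term ℕ, r.varFinset ⊆ z → eqVars (L := L) (Term.var w, r) ⊆ insert w z := by
    intro r hr
    refine Finset.union_subset (by simp [Term.varFinset]) (hr.trans (Finset.subset_insert _ _))
  have hβ₁ : ∀ e ∈ β₁, eqVars e ⊆ insert w z := by
    rintro e (rfl | he)
    · exact hvar t ht
    · exact he.1.trans (Finset.subset_insert _ _)
  have hβ₂ : ∀ e ∈ β₂, eqVars e ⊆ insert w z := by
    rintro e rfl
    exact hvar s hs
  have hP₁ : ∀ e ∈ P, Conseq E β₁ e := by
    refine hP' ∅ (by simp) β₁ (by simpa using fun a b h => by exact_mod_cast hβ₁ (a, b) h) ?_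
    refine hR' β₁ (fun e he => (hβ₁ e he).trans hzy) ?_
    intro d hd A _ hA f hf
    rw [Finset.mem_singleton.1 hd]
    have h₁ : s.realize f = t.realize f := h A hA f fun e he => hf e (by
      rcases he with he | he
      · exact Or.inl he
      · exact Or.inr (Or.inr he))
    have h₂ : f w = t.realize f := hf (Term.var w, t) (Or.inr (Or.inl rfl))
    exact h₁.trans h₂.symm
  -- ... as well as from `w = s` alone.
  have hP₂ : ∀ e ∈ P, Conseq E β₂ e := by
    refine hP' ∅ (by simp) β₂ (by simpa using fun a b h => by exact_mod_cast hβ₂ (a, b) h) ?_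
    refine hR' β₂ (fun e he => (hβ₂ e he).trans hzy) ?_
    intro d hd A _ hA f hf
    rw [Finset.mem_singleton.1 hd]
    exact (hf (Term.var w, s) (Or.inr rfl)).symm
  -- The subdirect product of `M`, with `w` read as `t`, and of the algebra presented by `G`, with
  -- `w` read as `s`, satisfies the interpolant.
  let C := Presented E (G : Set (Equation L ℕ))
  let c : ℕ → C := TermQuot.gen _
  have hC : InVariety E C := presented_inVariety E _
  let a' : ℕ → M := Function.update a w (t.realize a)
  let c' : ℕ → C := Function.update c w (s.realize c)
  have ha' : ∀ i ∈ z, a' i = a i := fun i hi =>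
    Function.update_of_ne (ne_of_mem_of_not_mem hi hwz) _ _
  have hc' : ∀ i ∈ z, c' i = c i := fun i hi =>
    Function.update_of_ne (ne_of_mem_of_not_mem hi hwz) _ _
  let θ := kerRealizeInf (L := L) a' c'
  have hB : InVariety E (TermQuot θ) := TermQuot.inVariety fun e he σ =>
    ⟨kerRealize_subst hM a' he σ, kerRealize_subst hC c' he σ⟩
  have hθ : ∀ e : Equation L ℕ, Holds (TermQuot.gen θ) e ↔ Holds a' e ∧ Holds c' e := fun e =>
    TermQuot.holds_gen
  have hPB : ∀ e ∈ P, Holds (TermQuot.gen θ) e := by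
    refine fun e he => (hθ e).2 ⟨hP₁ e he M hM a' ?_, hP₂ e he C hC c' ?_⟩
    · rintro d (rfl | hd)
      · change a' w = t.realize a'
        rw [realize_congr_vars t fun i hi => ha' i (ht hi)]
        simp [a']
      · exact (holds_congr_vars fun i hi => ha' i (hd.1 hi)).2 hd.2
    · rintro d rfl
      change c' w = s.realize c'
      rw [realize_congr_vars s fun i hi => hc' i (hs hi)]
      simp [c']
  -- It has the same equations in `z` as the algebra presented by `G`, so they amalgamate.
  obtain ⟨D, hDs, hD, i, k, hik⟩ := hAP.amalgamate hB hC (TermQuot.gen θ) c z fun e he => by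
    rw [hθ, holds_congr_vars (f := a') fun i hi => ha' i (he hi),
      holds_congr_vars (f := c') fun i hi => hc' i (he hi)]
    exact and_iff_right_of_imp fun hc => ha e he (holds_gen_presented.1 hc)
  let d : ℕ → D := Function.update (k ∘ c) w (i (TermQuot.gen θ w))
  have hdy : ∀ n ∈ y, d n = k (c n) := fun n hn =>
    Function.update_of_ne (ne_of_mem_of_not_mem hn hw.2) _ _
  have hdz : ∀ n ∈ insert w z, d n = i (TermQuot.gen θ n) := by
    intro n hn
    rcases Finset.mem_insert.1 hn with rfl | hn
    · simp [d]
    · rw [hdy n (Finset.mem_of_mem_erase hn), hik n hn]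
  have hdP : ∀ e ∈ P, Holds d e := fun e he =>
    (holds_congr_vars fun n hn => hdz n (hPz e he hn)).2 ((holds_embedding i).2 (hPB e he))
  have hdG : ∀ e ∈ G, Holds d e := fun e he =>
    (holds_congr_vars fun n hn => hdy n (hG e he hn)).2
      ((holds_embedding k).2 (holds_gen_of_mem (E := E) he))
  have hdε : Holds d ε := hR ε (by simp) D hD d (by
    rintro e (he | he)
    · exact hdG e he
    · exact hP e he D hD d hdP)
  have hB' : Holds (TermQuot.gen θ) ε :=
    (holds_embedding i).1 ((holds_congr_vars fun n hn => hdz n (hε hn)).1 hdε)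
  have := ((hθ ε).1 hB').1
  change s.realize a' = a' w at this
  rw [realize_congr_vars s fun i hi => ha' i (hs hi)] at this
  simpa [a', Holds] using this

/-- If the parameters satisfy the interpolants, the datum has a solution in an extension. -/
theorem EqInterpolants.exists_extension (hAP : AmalgamationProperty E)
    (hLeft : LeftUniformInterpolation E) (hRes : HasEqResiduals E) {j : Datum L}
    {S : Finset (Equation L ℕ)} {P : Fin j.n → Finset (Equation L ℕ)}
    (h : EqInterpolants E j S P) {M : Type (max u v)} [L.Structure M] (hM : InVariety E M)
    {a : ℕ → M} (ha : Sat a S P) :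
    ∃ (N : Type (max u v)) (_ : L.Structure N), InVariety E N ∧
      ∃ (i : M ↪[L] N) (b : N), Sat (Function.update (i ∘ a) j.x b) j.Γ j.Δ := by
  classical
  have hΓ : ∀ e, eqVars e ⊆ j.params → Conseq E (j.Γ : Set (Equation L ℕ)) e → Holds a e :=
    fun e he hc => (h.conseq_iff e he).2 hc M hM a ha.1
  let C := Presented E (j.Γ ∪ typeOf a j.params : Set (Equation L ℕ))
  let c : ℕ → C := TermQuot.gen _
  have hc : Sat c j.Γ j.Δ := by
    refine ⟨fun e he => holds_gen_of_mem (Or.inl he), fun m hm => ha.2 m ?_⟩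
    -- By compactness finitely many equations true of `a` would entail `Δ m` modulo `Γ`.
    obtain ⟨T, hT, hTD⟩ := Conseq.exists_finset_forall fun e he => holds_gen_presented.1 (hm e he)
    let T' := T.filter (· ∈ typeOf a j.params)
    have hT' : ∀ e ∈ T', e ∈ typeOf a j.params := fun e he => (Finset.mem_filter.1 he).2
    have := (h.forall_conseq_iff m T' fun e he => (hT' e he).1).2 fun e he =>
      (hTD e he).mono fun s hs => by
        rcases hT hs with h | h
        · exact Or.inl h
        · exact Or.inr (Finset.mem_filter.2 ⟨hs, h⟩)
    exact fun e he => this e he M hM a fun d hd => (hT' d hd).2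
  obtain ⟨N, hNs, hN, i, k, hik⟩ := hAP.amalgamate hM (presented_inVariety E _) a c j.params
    fun e he => ⟨fun hae => holds_gen_of_mem (Or.inr ⟨he, hae⟩), fun hce =>
      holds_of_conseq_union_typeOf hAP hLeft hRes j.x (fun e he => j.eqVars_Γ he) hM a hΓ he
        (holds_gen_presented.1 hce)⟩
  refine ⟨N, hNs, hN, i, k (c j.x), ?_⟩
  refine (sat_congr (y := j.vars) (fun e he => j.eqVars_Γ he) (fun m e he => j.eqVars_Δ m he)
    fun n hn => ?_).2 ((sat_embedding k).2 hc)
  by_cases hnx : n = j.x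
  · simp [hnx]
  · rw [Function.update_of_ne hnx]
    exact hik n (Finset.mem_erase.2 ⟨hnx, hn⟩)

end Extension

/-! ### Compact congruences -/

section Congruences

variable {L : FirstOrder.Language.{u, v}} {A B : Type*} [L.Structure A] [L.Structure B]

namespace AlgCon

theorem cg_le_iff {S : Set (A × A)} {θ : AlgCon L A} : cg S ≤ θ ↔ ∀ p ∈ S, θ.r p.1 p.2 := by
  constructor
  · exact fun h p hp => h _ _ fun ψ hψ => hψ p hp
  · exact fun h a b hab => hab θ h

theorem cg_of_mem {S : Set (A × A)} {p : A × A} (hp : p ∈ S) : (cg (L := L) S).r p.1 p.2 :=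
  cg_le_iff.1 le_rfl p hp

theorem map_le_iff {h : A →[L] B} {ψ : AlgCon L A} {θ : AlgCon L B} :
    map h ψ ≤ θ ↔ ψ ≤ comap h θ := by
  rw [map, cg_le_iff]
  constructor
  · exact fun H a b hab => H _ ⟨a, b, hab, rfl⟩
  · rintro H _ ⟨a, b, hab, rfl⟩
    exact H a b hab

/-- The union of a nonempty directed set of congruences. -/
def directedUnion (s : Set (AlgCon L A)) (hne : s.Nonempty) (hd : DirectedOn (· ≤ ·) s) :
    AlgCon L A where
  r a b := ∃ θ ∈ s, θ.r a b
  iseqv := by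
    refine ⟨fun a => hne.imp fun θ hθ => ⟨hθ, θ.iseqv.refl a⟩, ?_, ?_⟩
    · rintro a b ⟨θ, hθ, h⟩
      exact ⟨θ, hθ, θ.iseqv.symm h⟩
    · rintro a b c ⟨θ, hθ, h⟩ ⟨ψ, hψ, h'⟩
      obtain ⟨χ, hχ, h₁, h₂⟩ := hd θ hθ ψ hψ
      exact ⟨χ, hχ, χ.iseqv.trans (h₁ _ _ h) (h₂ _ _ h')⟩
  map_fun {n} f a b h := by
    choose θ hθ h using h
    have : Nonempty s := hne.to_subtype
    have hd' : Directed (· ≤ ·) (Subtype.val : s → AlgCon L A) := hd.directed_val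
    obtain ⟨z, hz⟩ := hd'.finite_le fun i => (⟨θ i, hθ i⟩ : s)
    exact ⟨z, z.2, z.1.map_fun f a b fun i => hz i _ _ (h i)⟩

theorem isCompactElement_cg {S : Set (A × A)} (hS : S.Finite) :
    IsCompactElement (cg (L := L) S) := by
  intro s u hne hd hu hle
  have hU : u ≤ directedUnion s hne hd := hu.2 fun θ hθ a b hab => ⟨θ, hθ, hab⟩
  have : Finite S := hS
  choose θ hθ h using fun p : S => hU _ _ (hle _ _ (cg_of_mem p.2))
  have : Nonempty s := hne.to_subtype
  have hd' : Directed (· ≤ ·) (Subtype.val : s → AlgCon L A) := hd.directed_val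
  obtain ⟨z, hz⟩ := hd'.finite_le fun p => (⟨θ p, hθ p⟩ : s)
  exact ⟨z, z.2, cg_le_iff.2 fun p hp => hz ⟨p, hp⟩ _ _ (h ⟨p, hp⟩)⟩

/-- Isomorphic algebras have isomorphic congruence lattices. -/
def congr (e : A ≃[L] B) : AlgCon L A ≃o AlgCon L B where
  toFun := comap e.symm.toHom
  invFun := comap e.toHom
  left_inv θ := ext' fun a b => by
    change θ.r (e.symm (e a)) (e.symm (e b)) ↔ _
    rw [e.symm_apply_apply, e.symm_apply_apply]
  right_inv θ := ext' fun a b => by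
    change θ.r (e (e.symm a)) (e (e.symm b)) ↔ _
    rw [e.apply_symm_apply, e.apply_symm_apply]
  map_rel_iff' {θ ψ} := by
    constructor
    · intro h a b hab
      have : ψ.r (e.symm (e a)) (e.symm (e b)) := h (e a) (e b) (by
        change θ.r (e.symm (e a)) (e.symm (e b))
        rwa [e.symm_apply_apply, e.symm_apply_apply])
      rwa [e.symm_apply_apply, e.symm_apply_apply] at this
    · exact fun h a b hab => h _ _ hab

end AlgCon

theorem isCompactElement_orderIso {P Q : Type*} [PartialOrder P] [PartialOrder Q] (e : P ≃o Q)
    {a : P} (ha : IsCompactElement a) : IsCompactElement (e a) := by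
  intro s u hne hd hu hle
  obtain ⟨x, ⟨y, hy, rfl⟩, hx⟩ := ha (e.symm '' s) (e.symm u) (hne.image _)
    (hd.mono_comp (fun _ _ h => e.symm.monotone h)) ((e.symm.isLUB_image').2 hu)
    (e.le_symm_apply.2 hle)
  exact ⟨y, hy, e.le_symm_apply.1 hx⟩

theorem DuallyBrouwerian.of_orderIso {P Q : Type*} [SemilatticeSup P] [SemilatticeSup Q]
    (e : P ≃o Q) (hP : DuallyBrouwerian P) : DuallyBrouwerian Q := by
  intro a b
  obtain ⟨d, hd⟩ := hP (e.symm a) (e.symm b)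
  refine ⟨e d, fun c => ?_⟩
  have := hd (e.symm c)
  rwa [e.le_symm_apply, ← e.symm.map_sup, e.symm.le_iff_le] at this

/-- Isomorphic algebras have isomorphic semilattices of compact congruences. -/
def KCon.congr (e : A ≃[L] B) : KCon L A ≃o KCon L B where
  toFun θ := ⟨AlgCon.congr e θ.1, isCompactElement_orderIso _ θ.2⟩
  invFun θ := ⟨(AlgCon.congr e).symm θ.1, isCompactElement_orderIso _ θ.2⟩
  left_inv θ := Subtype.ext ((AlgCon.congr e).symm_apply_apply θ.1)
  right_inv θ := Subtype.ext ((AlgCon.congr e).apply_symm_apply θ.1)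
  map_rel_iff' {θ ψ} := (AlgCon.congr e).le_iff_le (x := θ.1) (y := ψ.1)

end Congruences

/-! ### Congruences of finitely generated free algebras -/

theorem forall_mem_iff_relabel {L : FirstOrder.Language.{u, v}} {y : Finset ℕ}
    {G : Finset (Equation L ℕ)}
    (hG : ∀ e ∈ G, eqVars e ⊆ y) {p : Equation L ℕ → Prop} : (∀ e ∈ G, p e) ↔
      ∀ s t : L.Term y, (s.relabel Subtype.val, t.relabel Subtype.val) ∈ G →
        p (s.relabel Subtype.val, t.relabel Subtype.val) := by
  refine ⟨fun h s t hst => h _ hst, fun h e he => ?_⟩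
  obtain ⟨s, hs⟩ := exists_relabel_eq e.1 y (Finset.union_subset_left (hG e he))
  obtain ⟨t, ht⟩ := exists_relabel_eq e.2 y (Finset.union_subset_right (hG e he))
  obtain rfl : (s.relabel Subtype.val, t.relabel Subtype.val) = e := by rw [hs, ht]
  exact h s t he

theorem relabel_injective {L : FirstOrder.Language.{u, v}} {α β : Type*} {g : α → β}
    (hg : Function.Injective g) : Function.Injective (Term.relabel g : L.Term α → L.Term β) := by
  intro s
  induction s with
  | var i =>
    rintro (j | _) h
    · simp only [Term.relabel, Term.var.injEq] at h
      rw [hg h]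
    · simp [Term.relabel] at h
  | func f ts ih =>
    rintro (_ | ⟨f', ts'⟩) h
    · simp [Term.relabel] at h
    · simp only [Term.relabel, Term.func.injEq] at h
      obtain ⟨rfl, h₁, h₂⟩ := h
      rw [eq_of_heq h₁]
      exact congrArg _ (funext fun i => ih i (congrFun (eq_of_heq h₂) i))

section FreeAlg

variable {L : FirstOrder.Language.{u, v}} [L.IsAlgebraic] {E : Set (Equation L ℕ)}

theorem FreeAlg.exists_mk {α : Type w} (a : FreeAlg E α) : ∃ t, FreeAlg.mk E t = a :=
  Quotient.exists_rep a

theorem FreeAlg.funMap_mk {α : Type w} {n : ℕ} (f : L.Functions n) (ts : Fin n → L.Term α) :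
    Structure.funMap f (fun i => FreeAlg.mk E (ts i)) = FreeAlg.mk E (Term.func f ts) :=
  funMap_quotient_mk' (L := L) (freeCon E α).toSetoid f ts

theorem freeMap_mk {α β : Type w} (g : α → β) (t : L.Term α) :
    freeMap E g (FreeAlg.mk E t) = FreeAlg.mk E (t.relabel g) := rfl

theorem freeMap_leftInverse {α β : Type w} (e : α ≃ β) :
    Function.LeftInverse (freeMap E e.symm) (freeMap E e) := by
  intro a
  obtain ⟨t, rfl⟩ := FreeAlg.exists_mk a
  simp only [freeMap_mk, Term.relabel_relabel, Equiv.symm_comp_self, Term.relabel_id]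

/-- Two terms are identified by `θ_G` exactly if `G` entails that they are equal. -/
theorem theta_r_iff [Nonempty L.Constants] {y : Finset ℕ} {G : Finset (Equation L ℕ)}
    (hG : ∀ e ∈ G, eqVars e ⊆ y) (s t : L.Term y) :
    (theta E y G).r (FreeAlg.mk E s) (FreeAlg.mk E t) ↔
      Conseq E (G : Set (Equation L ℕ)) (s.relabel Subtype.val, t.relabel Subtype.val) := by
  classical
  constructor
  · intro h A _ hA f hf
    -- The kernel of the homomorphism `F(y) → A` given by `f` contains the generators of `θ_G`.
    let p : FreeAlg E y → A := Quotient.lift (fun t : L.Term y => t.realize (f ∘ Subtype.val))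
      fun s t hst => hst A hA _ (by simp)
    let θ : AlgCon L (FreeAlg E y) :=
      { r := fun a b => p a = p b
        iseqv := ⟨fun _ => rfl, fun h => h.symm, fun h₁ h₂ => h₁.trans h₂⟩
        map_fun := by
          intro n F a b hab
          choose a' ha using fun i => FreeAlg.exists_mk (a i)
          choose b' hb using fun i => FreeAlg.exists_mk (b i)
          obtain rfl : (fun i => FreeAlg.mk E (a' i)) = a := funext ha
          obtain rfl : (fun i => FreeAlg.mk E (b' i)) = b := funext hb
          rw [FreeAlg.funMap_mk, FreeAlg.funMap_mk]
          exact (kerRealize (f ∘ Subtype.val)).map_fun F a' b' hab }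
    have hθ : theta E y G ≤ θ := AlgCon.cg_le_iff.2 (by
      rintro _ ⟨s, t, hst, rfl⟩
      exact holds_relabel.1 (hf _ hst))
    exact holds_relabel.2 (hθ _ _ h)
  · intro h
    let θ : AlgCon L (L.Term y) :=
      { r := fun s t => (theta E y G).r (FreeAlg.mk E s) (FreeAlg.mk E t)
        iseqv := ⟨fun _ => (theta E y G).iseqv.refl _, fun h => (theta E y G).iseqv.symm h,
          fun h₁ h₂ => (theta E y G).iseqv.trans h₁ h₂⟩
        map_fun := fun F a b hab => by
          have := (theta E y G).map_fun F _ _ hab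
          rwa [FreeAlg.funMap_mk, FreeAlg.funMap_mk] at this }
    have hV : InVariety E (TermQuot θ) := TermQuot.inVariety fun e he σ => by
      have : FreeAlg.mk E (e.1.subst σ) = FreeAlg.mk E (e.2.subst σ) :=
        Quotient.sound (s := (freeCon E y).toSetoid) (entails_subst E ∅ he σ)
      change (theta E y G).r _ _
      rw [this]
    obtain ⟨c⟩ := ‹Nonempty L.Constants›
    let f : ℕ → TermQuot θ := fun n => if hn : n ∈ y then TermQuot.gen θ ⟨n, hn⟩ else
      TermQuot.mk θ c.term
    have hf : f ∘ (Subtype.val : y → ℕ) = TermQuot.gen θ := by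
      funext n
      simp [f]
    have := h (TermQuot θ) hV f fun e he => by
      obtain ⟨s, hs⟩ := exists_relabel_eq e.1 y (Finset.union_subset_left (hG e he))
      obtain ⟨t, ht⟩ := exists_relabel_eq e.2 y (Finset.union_subset_right (hG e he))
      obtain rfl : (s.relabel Subtype.val, t.relabel Subtype.val) = e := by rw [hs, ht]
      rw [holds_relabel, hf]
      exact TermQuot.holds_gen.2 (AlgCon.cg_of_mem (p := (_, _)) ⟨s, t, he, rfl⟩)
    rw [holds_relabel, hf] at this
    exact TermQuot.holds_gen.1 this

theorem theta_le_iff {y : Finset ℕ} {G : Finset (Equation L ℕ)}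
    {θ : AlgCon L (FreeAlg E y)} : theta E y G ≤ θ ↔ ∀ s t : L.Term y,
      (s.relabel Subtype.val, t.relabel Subtype.val) ∈ G →
        θ.r (FreeAlg.mk E s) (FreeAlg.mk E t) := by
  rw [theta, AlgCon.cg_le_iff]
  constructor
  · exact fun h s t hst => h _ ⟨s, t, hst, rfl⟩
  · rintro h _ ⟨s, t, hst, rfl⟩
    exact h s t hst

theorem theta_le_theta [Nonempty L.Constants] {y : Finset ℕ} {G H : Finset (Equation L ℕ)}
    (hG : ∀ e ∈ G, eqVars e ⊆ y) (hH : ∀ e ∈ H, eqVars e ⊆ y) :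
    theta E y G ≤ theta E y H ↔ ∀ e ∈ G, Conseq E (H : Set (Equation L ℕ)) e := by
  rw [theta_le_iff, forall_mem_iff_relabel hG]
  simp only [theta_r_iff hH]

theorem theta_union [DecidableEq (Equation L ℕ)] (y : Finset ℕ) (G H : Finset (Equation L ℕ)) :
    theta E y (G ∪ H) = theta E y G ⊔ theta E y H := by
  refine eq_of_forall_ge_iff fun θ => ?_
  simp only [sup_le_iff, theta_le_iff, Finset.mem_union, or_imp, forall_and]

theorem map_incl_theta {z y : Finset ℕ} (h : z ⊆ y) {C : Finset (Equation L ℕ)}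
    (hC : ∀ e ∈ C, eqVars e ⊆ z) : AlgCon.map (incl E h) (theta E z C) = theta E y C := by
  have key : ∀ s : L.Term z, ((s.relabel fun k : z => (⟨k.1, h k.2⟩ : y)).relabel Subtype.val :
      L.Term ℕ) = s.relabel Subtype.val := fun s => by
    rw [Term.relabel_relabel]
    rfl
  refine eq_of_forall_ge_iff fun θ => ?_
  rw [AlgCon.map_le_iff, theta_le_iff]
  constructor
  · intro H
    rw [theta_le_iff]
    intro s t hst
    obtain ⟨s', hs⟩ := exists_relabel_eq _ z (Finset.union_subset_left (hC _ hst))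
    obtain ⟨t', ht⟩ := exists_relabel_eq _ z (Finset.union_subset_right (hC _ hst))
    have inj : Function.Injective (Term.relabel Subtype.val : L.Term y → L.Term ℕ) :=
      relabel_injective Subtype.val_injective
    have hs' : (s'.relabel fun k : z => (⟨k.1, h k.2⟩ : y)) = s := inj ((key s').trans hs)
    have ht' : (t'.relabel fun k : z => (⟨k.1, h k.2⟩ : y)) = t := inj ((key t').trans ht)
    have := H s' t' (by rwa [hs, ht])
    change θ.r (FreeAlg.mk E _) (FreeAlg.mk E _) at this
    rwa [hs', ht'] at this
  · intro H s t hst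
    exact theta_le_iff.1 H _ _ (by rwa [key, key])

theorem comap_incl_theta_r [Nonempty L.Constants] {z y : Finset ℕ} (h : z ⊆ y)
    {G : Finset (Equation L ℕ)} (hG : ∀ e ∈ G, eqVars e ⊆ y) (s t : L.Term z) :
    (AlgCon.comap (incl E h) (theta E y G)).r (FreeAlg.mk E s) (FreeAlg.mk E t) ↔
      Conseq E (G : Set (Equation L ℕ)) (s.relabel Subtype.val, t.relabel Subtype.val) := by
  refine (theta_r_iff hG _ _).trans ?_
  rw [Term.relabel_relabel, Term.relabel_relabel]
  rfl

theorem isCompactElement_theta (y : Finset ℕ) (G : Finset (Equation L ℕ)) :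
    IsCompactElement (theta E y G) := by
  refine AlgCon.isCompactElement_cg ?_
  have inj : Function.Injective fun p : L.Term y × L.Term y =>
      ((p.1.relabel Subtype.val, p.2.relabel Subtype.val) : Equation L ℕ) := by
    have := relabel_injective (L := L) (Subtype.val_injective (p := (· ∈ y)))
    exact this.prodMap this
  refine (((G.finite_toSet).preimage inj.injOn).image
    fun p => (FreeAlg.mk E p.1, FreeAlg.mk E p.2)).subset ?_
  rintro _ ⟨s, t, hst, rfl⟩
  exact ⟨(s, t), hst, rfl⟩

theorem exists_eq_theta {y : Finset ℕ} {θ : AlgCon L (FreeAlg E y)} (hθ : IsCompactElement θ) :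
    ∃ G : Finset (Equation L ℕ), (∀ e ∈ G, eqVars e ⊆ y) ∧ θ = theta E y G := by
  classical
  let s : Set (AlgCon L (FreeAlg E y)) :=
    {ψ | ∃ G : Finset (Equation L ℕ), (∀ e ∈ G, eqVars e ⊆ y) ∧ theta E y G ≤ θ ∧
      ψ = theta E y G}
  have hne : s.Nonempty := ⟨_, ∅, by simp, theta_le_iff.2 (by simp), rfl⟩
  have hdir : DirectedOn (· ≤ ·) s := by
    rintro _ ⟨G, hG, hle, rfl⟩ _ ⟨G', hG', hle', rfl⟩
    refine ⟨_, ⟨G ∪ G', ?_, ?_, rfl⟩, ?_, ?_⟩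
    · simpa only [Finset.mem_union, or_imp, forall_and] using ⟨hG, hG'⟩
    · rw [theta_union]
      exact sup_le hle hle'
    · rw [theta_union]
      exact le_sup_left
    · rw [theta_union]
      exact le_sup_right
  have hlub : IsLUB s θ := by
    refine ⟨?_, fun ψ hψ a b hab => ?_⟩
    · rintro _ ⟨G, -, hle, rfl⟩
      exact hle
    · obtain ⟨s, rfl⟩ := FreeAlg.exists_mk a
      obtain ⟨t, rfl⟩ := FreeAlg.exists_mk b
      refine theta_le_iff.1 (hψ ⟨{(s.relabel Subtype.val, t.relabel Subtype.val)}, ?_, ?_, rfl⟩)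
        s t (by simp)
      · intro e he
        rw [Finset.mem_singleton.1 he]
        exact eqVars_relabel_subset s t
      · rw [theta_le_iff]
        intro s' t' h'
        have inj := relabel_injective (L := L) (Subtype.val_injective (p := (· ∈ y)))
        simp only [Finset.mem_singleton, Prod.mk.injEq] at h'
        rw [inj h'.1, inj h'.2]
        exact hab
  obtain ⟨_, ⟨G, hG, hle, rfl⟩, h⟩ := hθ s θ hne hdir hlub le_rfl
  exact ⟨G, hG, le_antisymm h hle⟩

/-- Free algebras on finitely many generators satisfy the hypothesis on finitely presented
algebras, which concerns algebras in a possibly larger universe. -/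
theorem duallyBrouwerian_freeAlg
    (hBr : ∀ (A : Type (max u v)) [L.Structure A], InVariety E A →
      FinitelyPresented E A → DuallyBrouwerian (KCon L A)) (y : Finset ℕ) :
    DuallyBrouwerian (KCon L (FreeAlg E y)) := by
  let e : TermQuot (freeCon E y) ≃[L] FreeAlg E y :=
    { toEquiv := Equiv.ulift
      map_fun' := fun _ _ => rfl
      map_rel' := fun r => isEmptyElim r }
  let g := y.equivFin
  refine (hBr (TermQuot (freeCon E y)) ?_ ?_).of_orderIso (KCon.congr e)
  · exact TermQuot.inVariety fun d hd σ => entails_subst E ∅ hd σ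
  · have hinj : Function.Injective (freeMap E g.symm) := (freeMap_leftInverse g.symm).injective
    refine ⟨y.card, e.symm.toHom.comp (freeMap E g.symm), ?_, ?_⟩
    · exact e.symm.surjective.comp (freeMap_leftInverse (E := E) g).surjective
    · have : AlgCon.ker (e.symm.toHom.comp (freeMap E g.symm)) = ⊥ := by
        refine eq_bot_iff.2 fun a b hab => ?_
        obtain rfl : a = b := hinj (e.symm.injective hab)
        exact (⊥ : AlgCon L _).iseqv.refl a
      rw [this]
      exact fun s u hne _ _ _ => hne.imp fun x hx => ⟨hx, bot_le⟩

end FreeAlg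

/-! ### Residuals and interpolants in terms of equations -/

theorem exists_eqInterpolants {L : FirstOrder.Language.{u, v}} {E : Set (Equation L ℕ)}
    (hLeft : LeftUniformInterpolation E) (hRight : RightUniformInterpolation E)
    (hRes : HasEqResiduals E) (j : Datum L) :
    ∃ (S : Finset (Equation L ℕ)) (P : Fin j.n → Finset (Equation L ℕ)),
      EqInterpolants E j S P := by
  classical
  have hx : j.x ∉ j.params := Finset.notMem_erase _ _
  have hsub : j.vars ⊆ {j.x} ∪ j.params := fun k hk => by
    by_cases hkx : k = j.x
    · simp [hkx]
    · exact Finset.mem_union_right _ (Finset.mem_erase.2 ⟨hkx, hk⟩)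
  obtain ⟨S, hS, hΓS, hS'⟩ := hRight {j.x} j.params (by simpa using hx) j.Γ
    fun e he => (j.eqVars_Γ he).trans hsub
  choose R hR hR' using fun m => hRes j.vars j.Γ (j.Δ m) (fun e he => j.eqVars_Γ he)
    fun e he => j.eqVars_Δ m he
  choose P hP hPR hP' using fun m => hLeft j.params {j.x} (by simpa using hx) (R m)
    fun e he => ((hR m e he).trans hsub).trans (Finset.union_comm _ _).subset
  refine ⟨S, P, hS, hP, fun e he => ⟨fun h => h.trans hΓS, fun h => ?_⟩, fun m C hC => ?_⟩
  · exact hS' ∅ (by simp) e (by simpa using he) h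
  · rw [← hR' m C fun e he => (hC e he).trans (Finset.erase_subset _ _)]
    refine ⟨fun h e he => (hPR m e he).trans h, fun h => ?_⟩
    exact hP' m ∅ (by simp) C (fun e he => by simpa using hC e he) h

section Interpolants

variable {L : FirstOrder.Language.{u, v}} [L.IsAlgebraic] [Nonempty L.Constants]
  {E : Set (Equation L ℕ)}

/-- The residual `θ_D - θ_G` lies below `θ_C` exactly if `G` and `C` together entail `D`. -/
theorem isResidual_theta_iff {y : Finset ℕ} {G D C : Finset (Equation L ℕ)}
    (hG : ∀ e ∈ G, eqVars e ⊆ y) (hD : ∀ e ∈ D, eqVars e ⊆ y) (hC : ∀ e ∈ C, eqVars e ⊆ y)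
    {g a d : KCon L (FreeAlg E y)} (hg : g.1 = theta E y G) (ha : a.1 = theta E y D)
    (h : IsResidual a g d) :
    d.1 ≤ theta E y C ↔ ∀ e ∈ D, Conseq E (G ∪ C : Set (Equation L ℕ)) e := by
  classical
  have hGC : ∀ e ∈ G ∪ C, eqVars e ⊆ y := by
    simpa only [Finset.mem_union, or_imp, forall_and] using ⟨hG, hC⟩
  have h' : d.1 ≤ theta E y C ↔ a.1 ≤ g.1 ⊔ theta E y C :=
    h ⟨theta E y C, isCompactElement_theta y C⟩
  rw [h', hg, ha, ← theta_union, theta_le_theta hD hGC, Finset.coe_union]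

theorem hasEqResiduals
    (hBr : ∀ y : Finset ℕ, DuallyBrouwerian (KCon L (FreeAlg E y))) : HasEqResiduals E := by
  intro y G D hG hD
  obtain ⟨d, hd⟩ := hBr y ⟨theta E y D, isCompactElement_theta y D⟩
    ⟨theta E y G, isCompactElement_theta y G⟩
  obtain ⟨R, hR, hdR⟩ := exists_eq_theta d.2
  refine ⟨R, hR, fun C hC => ?_⟩
  rw [← theta_le_theta hR hC, ← hdR]
  exact isResidual_theta_iff hG hD hC rfl rfl hd

theorem Interpolants.eqInterpolants {j : Datum L} {S : Finset (Equation L ℕ)}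
    {P : Fin j.n → Finset (Equation L ℕ)} (h : Interpolants E j S P) :
    EqInterpolants E j S P := by
  obtain ⟨hS, hP, hSΓ, hres⟩ := h
  refine ⟨hS, hP, fun e he => ?_, fun m C hC => ?_⟩
  · obtain ⟨s, hs⟩ := exists_relabel_eq e.1 j.params (Finset.union_subset_left he)
    obtain ⟨t, ht⟩ := exists_relabel_eq e.2 j.params (Finset.union_subset_right he)
    obtain rfl : (s.relabel Subtype.val, t.relabel Subtype.val) = e := by rw [hs, ht]
    rw [← theta_r_iff hS s t, hSΓ]
    exact comap_incl_theta_r _ (fun e he => j.eqVars_Γ he) s t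
  · obtain ⟨g, a, d, hg, ha, hd, hψ⟩ := hres m
    have := hψ ⟨theta E j.params C, isCompactElement_theta _ C⟩
    rw [theta_le_theta (hP m) hC] at this
    refine this.trans ((iff_of_eq (congrArg (d.1 ≤ ·) (map_incl_theta _ hC))).trans ?_)
    exact (isResidual_theta_iff (fun e he => j.eqVars_Γ he)
      (fun e he => j.eqVars_Δ m he) (fun e he => (hC e he).trans (Finset.erase_subset _ _))
      hg ha hd)

theorem EqInterpolants.interpolants
    (hBr : ∀ y : Finset ℕ, DuallyBrouwerian (KCon L (FreeAlg E y))) {j : Datum L}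
    {S : Finset (Equation L ℕ)} {P : Fin j.n → Finset (Equation L ℕ)}
    (h : EqInterpolants E j S P) : Interpolants E j S P := by
  refine ⟨h.vars_left, h.vars_right, AlgCon.ext' fun a b => ?_, fun m => ?_⟩
  · obtain ⟨s, rfl⟩ := FreeAlg.exists_mk a
    obtain ⟨t, rfl⟩ := FreeAlg.exists_mk b
    rw [theta_r_iff h.vars_left s t, h.conseq_iff _ (eqVars_relabel_subset s t)]
    exact (comap_incl_theta_r _ (fun e he => j.eqVars_Γ he) s t).symm
  · obtain ⟨d, hd⟩ := hBr j.vars ⟨theta E j.vars (j.Δ m), isCompactElement_theta _ _⟩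
      ⟨theta E j.vars j.Γ, isCompactElement_theta _ _⟩
    refine ⟨_, _, d, rfl, rfl, hd, fun ψ => ?_⟩
    obtain ⟨C, hC, hψ⟩ := exists_eq_theta ψ.2
    rw [hψ, theta_le_theta (h.vars_right m) hC, h.forall_conseq_iff m C hC]
    refine Iff.trans ?_ (iff_of_eq (congrArg (d.1 ≤ ·) (map_incl_theta _ hC).symm))
    exact (isResidual_theta_iff (fun e he => j.eqVars_Γ he)
      (fun e he => j.eqVars_Δ m he) (fun e he => (hC e he).trans (Finset.erase_subset _ _))
      rfl rfl hd).symm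

end Interpolants

/-! ### Extensions in which all data are solvable -/

section Closed

variable {L : FirstOrder.Language.{u, v}} {E : Set (Equation L ℕ)}
  {S : Datum L → Finset (Equation L ℕ)} {P : (j : Datum L) → Fin j.n → Finset (Equation L ℕ)}

variable (S P) in
/-- A datum with parameters from `M` satisfying the condition `S`, `P`, which is to be solved in
an extension of `M`. -/
def Task (M : Type*) [L.Structure M] : Type _ :=
  {p : Datum L × (ℕ → M) // Sat p.2 (S p.1) (P p.1)}

/-- The task has a solution in the extension `i`. -/
def Task.Solved {M N : Type*} [L.Structure M] [L.Structure N] (p : Task S P M) (i : M ↪[L] N) :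
    Prop :=
  ∃ b, Sat (Function.update (i ∘ p.1.2) p.1.1.x b) p.1.1.Γ p.1.1.Δ

theorem Task.Solved.comp {M N N' : Type*} [L.Structure M] [L.Structure N] [L.Structure N']
    {p : Task S P M} {i : M ↪[L] N} (h : p.Solved i) (k : N ↪[L] N') : p.Solved (k.comp i) := by
  obtain ⟨b, hb⟩ := h
  refine ⟨k b, ?_⟩
  rw [← sat_embedding k, Function.comp_update] at hb
  exact hb

/-- Relabelling the variables of an equation. -/
def relabelEq {α β : Type*} (g : α → β) (e : Equation L α) : Equation L β :=
  (e.1.relabel g, e.2.relabel g)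

theorem holds_relabelEq {α β A : Type*} [L.Structure A] {g : α → β} {f : β → A}
    {e : Equation L α} : Holds f (relabelEq g e) ↔ Holds (f ∘ g) e := holds_relabel

theorem exists_of_finset {G : ℕ → Type w} [∀ i, L.Structure (G i)] [∀ i, Nonempty (G i)]
    (f : ∀ n, G n ↪[L] G (n + 1)) (y : Finset ℕ)
    (a : ℕ → Language.DirectLimit G fun i j h => DirectedSystem.natLERec f i j h) :
    ∃ (i : ℕ) (a' : ℕ → G i), ∀ n ∈ y,
      DirectLimit.of L ℕ G (fun i j h => DirectedSystem.natLERec f i j h) i (a' n) = a n := by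
  obtain ⟨i, b, hb⟩ := DirectLimit.exists_quotient_mk'_sigma_mk'_eq G
    (fun i j h => DirectedSystem.natLERec f i j h) (fun n : y => a n)
  refine ⟨i, fun n => if h : n ∈ y then b ⟨n, h⟩ else Classical.arbitrary _, fun n hn => ?_⟩
  simp only [dif_pos hn, DirectLimit.of_apply]
  exact (congrFun hb ⟨n, hn⟩).symm

theorem of_succ {G : ℕ → Type w} [∀ i, L.Structure (G i)]
    (f : ∀ n, G n ↪[L] G (n + 1)) (n : ℕ) (a : G n) :
    DirectLimit.of L ℕ G (fun i j h => DirectedSystem.natLERec f i j h) (n + 1) (f n a) =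
      DirectLimit.of L ℕ G (fun i j h => DirectedSystem.natLERec f i j h) n a := by
  rw [← DirectLimit.of_f (hij := n.le_succ)]
  congr 1
  rw [DirectedSystem.coe_natLERec]
  exact (Nat.leRecOn_succ' (C := G) (next := fun {k} => f k) a).symm

/-- In the union of a chain of extensions, each of which solves all tasks over the preceding one,
every datum is solvable whenever its parameters satisfy the condition `S`, `P`. -/
theorem exists_union_of_chain (hS : ∀ j, ∀ e ∈ S j, eqVars e ⊆ j.params)
    (hP : ∀ j m, ∀ e ∈ P j m, eqVars e ⊆ j.params) {G : ℕ → Type w} [∀ i, L.Structure (G i)]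
    [∀ i, Nonempty (G i)] (f : ∀ n, G n ↪[L] G (n + 1)) (hG : ∀ n, InVariety E (G n))
    (hf : ∀ n (p : Task S P (G n)), p.Solved (f n)) :
    ∃ (N : Type w) (_ : L.Structure N), InVariety E N ∧ Nonempty (G 0 ↪[L] N) ∧
      ∀ (j : Datum L) (a : ℕ → N), Sat a (S j) (P j) →
        ∃ b, Sat (Function.update a j.x b) j.Γ j.Δ := by
  let o := DirectLimit.of L ℕ G fun i j h => DirectedSystem.natLERec f i j h
  refine ⟨Language.DirectLimit G fun i j h => DirectedSystem.natLERec f i j h, inferInstance,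
    fun e he a => ?_, ⟨o 0⟩, fun j a ha => ?_⟩
  · obtain ⟨i, a', ha'⟩ := exists_of_finset f (eqVars e) a
    exact (holds_congr_vars ha').1 ((holds_embedding (o i)).2 (hG i e he a'))
  · obtain ⟨i, a', ha'⟩ := exists_of_finset f j.params a
    have hi : Sat a' (S j) (P j) := (sat_embedding (o i)).1
      ((sat_congr (hS j) (hP j) ha').2 ha)
    obtain ⟨b, hb⟩ := hf i ⟨(j, a'), hi⟩
    refine ⟨o (i + 1) b, (sat_congr (y := j.vars) (fun e he => j.eqVars_Γ he)
      (fun m e he => j.eqVars_Δ m he) fun n hn => ?_).1 ((sat_embedding (o (i + 1))).2 hb)⟩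
    by_cases hnx : n = j.x
    · simp [hnx]
    · rw [Function.update_of_ne hnx, Function.comp_apply, Function.update_of_ne hnx,
        ← ha' n (Finset.mem_erase.2 ⟨hnx, hn⟩)]
      exact of_succ f i (a' n)

variable (E) in
/-- An algebra of the variety. -/
structure VarietyAlg where
  /-- The underlying type. -/
  carrier : Type (max u v)
  [struc : L.Structure carrier]
  mem : InVariety E carrier

attribute [instance] VarietyAlg.struc

/-- The iteration of an operation that extends algebras. -/
def iterateExtension (next : VarietyAlg E → VarietyAlg E) (A : VarietyAlg E) : ℕ → VarietyAlg E
  | 0 => A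
  | n + 1 => next (iterateExtension next A n)

variable [L.IsAlgebraic]

/-- Finitely many tasks can be solved one after the other, since an embedding preserves their
conditions. -/
theorem exists_extension_finset (hAP : AmalgamationProperty E)
    (hLeft : LeftUniformInterpolation E) (hRes : HasEqResiduals E)
    (hSP : ∀ j, EqInterpolants E j (S j) (P j)) {M : Type (max u v)} [L.Structure M]
    (hM : InVariety E M) (F : Finset (Task S P M)) :
    ∃ (N : Type (max u v)) (_ : L.Structure N), InVariety E N ∧
      ∃ i : M ↪[L] N, ∀ p ∈ F, p.Solved i := by
  classical
  induction F using Finset.induction with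
  | empty => exact ⟨M, inferInstance, hM, Embedding.refl L M, by simp⟩
  | insert p F _ ih =>
    obtain ⟨N, _, hN, i, hi⟩ := ih
    obtain ⟨N', _, hN', i', b, hb⟩ := (hSP p.1.1).exists_extension hAP hLeft hRes hN
      ((sat_embedding i).2 p.2)
    refine ⟨N', inferInstance, hN', i'.comp i, fun q hq => ?_⟩
    rcases Finset.mem_insert.1 hq with rfl | hq
    · exact ⟨b, hb⟩
    · exact (hi q hq).comp i'

/-- The reading of the variables of a task in terms of the elements of `M` and a new element for
each task. -/
def Task.var {M : Type*} [L.Structure M] (p : Task S P M) : ℕ → M ⊕ Task S P M :=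
  Function.update (Sum.inl ∘ p.1.2) p.1.1.x (Sum.inr p)

variable (S P) in
/-- The relations between the elements of `M` together with the equations of all tasks. -/
def taskRelations (M : Type*) [L.Structure M] : Set (Equation L (M ⊕ Task S P M)) :=
  {e | ∃ d : Equation L M, Holds id d ∧ e = relabelEq Sum.inl d} ∪
    {e | ∃ p : Task S P M, ∃ d ∈ p.1.1.Γ, e = relabelEq p.var d}

/-- A finite set of the relations, together with the inequations of finitely many tasks, is
satisfiable in an extension of `M`. -/
theorem exists_assignment_finset (hAP : AmalgamationProperty E)
    (hLeft : LeftUniformInterpolation E) (hRes : HasEqResiduals E)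
    (hSP : ∀ j, EqInterpolants E j (S j) (P j)) {M : Type (max u v)} [L.Structure M]
    (hM : InVariety E M) {T : Finset (Equation L (M ⊕ Task S P M))}
    (hT : (T : Set (Equation L (M ⊕ Task S P M))) ⊆ taskRelations S P M)
    (F : Finset (Task S P M)) :
    ∃ (N : Type (max u v)) (_ : L.Structure N), InVariety E N ∧
      ∃ (i : M ↪[L] N) (g : M ⊕ Task S P M → N), g ∘ Sum.inl = i ∧ (∀ e ∈ T, Holds g e) ∧
        ∀ p ∈ F, Sat (g ∘ p.var) p.1.1.Γ p.1.1.Δ := by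
  classical
  have hT' : ∃ F' : Finset (Task S P M), ∀ e ∈ T,
      (∃ d : Equation L M, Holds id d ∧ e = relabelEq Sum.inl d) ∨
        ∃ p ∈ F', ∃ d ∈ p.1.1.Γ, e = relabelEq p.var d := by
    have : ∀ e, ∃ F' : Finset (Task S P M), e ∈ T →
        (∃ d : Equation L M, Holds id d ∧ e = relabelEq Sum.inl d) ∨
          ∃ p ∈ F', ∃ d ∈ p.1.1.Γ, e = relabelEq p.var d := by
      intro e
      by_cases he : e ∈ T
      · rcases hT he with h | ⟨p, hp⟩
        · exact ⟨∅, fun _ => Or.inl h⟩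
        · exact ⟨{p}, fun _ => Or.inr ⟨p, by simp, hp⟩⟩
      · exact ⟨∅, fun h => (he h).elim⟩
    choose F' hF' using this
    refine ⟨T.biUnion F', fun e he => (hF' e he).imp_right ?_⟩
    rintro ⟨p, hp, h⟩
    exact ⟨p, Finset.mem_biUnion.2 ⟨e, he, hp⟩, h⟩
  obtain ⟨F', hF'⟩ := hT'
  obtain ⟨N, _, hN, i, hi⟩ := exists_extension_finset hAP hLeft hRes hSP hM (F ∪ F')
  let b : Task S P M → N := fun p => if h : p.Solved i then h.choose else i (p.1.2 0)
  let g : M ⊕ Task S P M → N := Sum.elim i b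
  have hg : ∀ p ∈ F ∪ F', Sat (g ∘ p.var) p.1.1.Γ p.1.1.Δ := by
    intro p hp
    have h := (hi p hp).choose_spec
    have : g ∘ p.var = Function.update (i ∘ p.1.2) p.1.1.x (hi p hp).choose := by
      rw [Task.var, Function.comp_update]
      simp only [g, b, Sum.elim_inr, hi p hp, dif_pos]
      rfl
    rwa [this]
  refine ⟨N, inferInstance, hN, i, g, rfl, fun e he => ?_, fun p hp =>
    hg p (Finset.mem_union_left _ hp)⟩
  rcases hF' e he with ⟨d, hd, rfl⟩ | ⟨p, hp, d, hd, rfl⟩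
  · exact holds_relabelEq.2 ((holds_embedding i).2 hd)
  · exact holds_relabelEq.2 ((hg p (Finset.mem_union_right _ hp)).1 d hd)

/-- All tasks over `M` can be solved in one extension of `M`. -/
theorem exists_extension_solving (hAP : AmalgamationProperty E)
    (hLeft : LeftUniformInterpolation E) (hRes : HasEqResiduals E)
    (hSP : ∀ j, EqInterpolants E j (S j) (P j)) {M : Type (max u v)} [L.Structure M]
    (hM : InVariety E M) :
    ∃ (N : Type (max u v)) (_ : L.Structure N), InVariety E N ∧
      ∃ i : M ↪[L] N, ∀ p : Task S P M, p.Solved i := by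
  classical
  let N := Presented E (taskRelations S P M)
  let c : M ⊕ Task S P M → N := TermQuot.gen _
  have hc : ∀ d : Equation L M, Holds id d → Holds (c ∘ Sum.inl) d := fun d hd =>
    holds_relabelEq.1 (holds_gen_of_mem (Or.inl ⟨d, hd, rfl⟩))
  let h : M →[L] N :=
    { toFun := c ∘ Sum.inl
      map_fun' := fun {n} F x =>
        hc (Term.var (Structure.funMap F x), Term.func F fun k => Term.var (x k)) rfl
      map_rel' := fun r => isEmptyElim r }
  have hinj : Function.Injective h := by
    intro m m' hm
    have : Entails E (taskRelations S P M) (Term.var (Sum.inl m), Term.var (Sum.inl m')) :=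
      holds_gen_presented.1 hm
    obtain ⟨T, hT, hTe⟩ := this.exists_finset
    obtain ⟨N', _, hN', i, g, hgi, hgT, -⟩ :=
      exists_assignment_finset hAP hLeft hRes hSP hM hT ∅
    have : g (Sum.inl m) = g (Sum.inl m') := hTe N' hN' g hgT
    exact i.injective (by rwa [← hgi])
  refine ⟨N, inferInstance, presented_inVariety E _, embeddingOfInjective h hinj, fun p =>
    ⟨c (Sum.inr p), ?_⟩⟩
  have hp : Function.update (embeddingOfInjective h hinj ∘ p.1.2) p.1.1.x (c (Sum.inr p)) =
      c ∘ p.var := by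
    rw [Task.var, Function.comp_update]
    rfl
  rw [hp]
  refine ⟨fun e he => holds_relabelEq.1 (holds_gen_of_mem (Or.inr ⟨p, e, he, rfl⟩)),
    fun m hm => ?_⟩
  have : ∀ e ∈ (p.1.1.Δ m).image (relabelEq p.var), Entails E (taskRelations S P M) e := by
    intro e he
    obtain ⟨d, hd, rfl⟩ := Finset.mem_image.1 he
    exact holds_gen_presented.1 (holds_relabelEq.2 (hm d hd))
  obtain ⟨T, hT, hTe⟩ := Entails.exists_finset_forall this
  obtain ⟨N', _, hN', i, g, hgi, hgT, hg⟩ :=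
    exists_assignment_finset hAP hLeft hRes hSP hM hT {p}
  refine (hg p (by simp)).2 m fun d hd => holds_relabelEq.1 ?_
  exact hTe _ (Finset.mem_image_of_mem _ hd) N' hN' g hgT

/-- Every algebra of the variety embeds in one in which every datum is solvable whenever its
parameters satisfy the condition `S`, `P`. -/
theorem exists_extension_closed [Nonempty L.Constants]
    (hAP : AmalgamationProperty E) (hLeft : LeftUniformInterpolation E) (hRes : HasEqResiduals E)
    (hSP : ∀ j, EqInterpolants E j (S j) (P j)) {M : Type (max u v)} [L.Structure M]
    (hM : InVariety E M) :
    ∃ (N : Type (max u v)) (_ : L.Structure N), InVariety E N ∧ Nonempty (M ↪[L] N) ∧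
      ∀ (j : Datum L) (a : ℕ → N), Sat a (S j) (P j) →
        ∃ b, Sat (Function.update a j.x b) j.Γ j.Δ := by
  have step : ∀ A : VarietyAlg E, ∃ (B : VarietyAlg E) (i : A.carrier ↪[L] B.carrier),
      ∀ p : Task S P A.carrier, p.Solved i := fun A => by
    obtain ⟨N, _, hN, i, hi⟩ := exists_extension_solving hAP hLeft hRes hSP A.mem
    exact ⟨⟨N, hN⟩, i, hi⟩
  choose next emb hemb using step
  let A : ℕ → VarietyAlg E := iterateExtension next ⟨M, hM⟩
  obtain ⟨c⟩ := ‹Nonempty L.Constants›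
  have : ∀ n, Nonempty (A n).carrier := fun n =>
    ⟨Structure.funMap (L := L) (n := 0) c default⟩
  exact exists_union_of_chain (G := fun n => (A n).carrier) (fun j => (hSP j).vars_left)
    (fun j => (hSP j).vars_right) (fun n => emb (A n)) (fun n => (A n).mem) fun n => hemb (A n)

end Closed

/-! ### The axioms and their models -/

section Axioms

variable {L : FirstOrder.Language.{u, v}}

theorem realize_phi {A : Type*} [L.Structure A] {f : ℕ → A} {G : Finset (Equation L ℕ)} {n : ℕ}
    {D : Fin n → Finset (Equation L ℕ)} : (phi G D).Realize f ↔ Sat f G D := by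
  have h : ∀ G : Finset (Equation L ℕ), (conjEqs G).Realize f ↔ ∀ e ∈ G, Holds f e := by
    intro G
    simp only [conjEqs, Formula.realize_iInf, Formula.realize_equal, Subtype.forall]
    rfl
  simp only [phi, Formula.realize_inf, Formula.realize_iInf, Formula.realize_not, h, Sat]

theorem isQF_foldr_inf {α : Type*} {l : List (L.Formula α)} (h : ∀ φ ∈ l, φ.IsQF) :
    (l.foldr (· ⊓ ·) ⊤ : L.Formula α).IsQF := by
  induction l with
  | nil => exact BoundedFormula.IsQF.top
  | cons φ l ih =>
    exact (h φ (by simp)).inf (ih fun ψ hψ => h ψ (by simp [hψ]))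

theorem isQF_foldr_sup {α : Type*} {l : List (L.Formula α)} (h : ∀ φ ∈ l, φ.IsQF) :
    (l.foldr (· ⊔ ·) ⊥ : L.Formula α).IsQF := by
  induction l with
  | nil => exact BoundedFormula.isQF_bot
  | cons φ l ih =>
    exact (h φ (by simp)).sup (ih fun ψ hψ => h ψ (by simp [hψ]))

theorem isQF_iInf {α β : Type*} [Finite β] {φ : β → L.Formula α} (h : ∀ b, (φ b).IsQF) :
    (Formula.iInf φ).IsQF := by
  refine isQF_foldr_inf fun ψ hψ => ?_
  obtain ⟨b, -, rfl⟩ := List.mem_map.1 hψ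
  exact h b

theorem isQF_phi (G : Finset (Equation L ℕ)) {n : ℕ} (D : Fin n → Finset (Equation L ℕ)) :
    (phi G D).IsQF := by
  have h : ∀ G : Finset (Equation L ℕ), (conjEqs G).IsQF := fun G =>
    isQF_iInf fun e => (BoundedFormula.IsAtomic.equal _ _).isQF
  exact (h G).inf (isQF_iInf fun m => (h (D m)).not)

theorem realize_existsVar {A : Type*} [L.Structure A] {f : ℕ → A} {x : ℕ} {φ : L.Formula ℕ} :
    (existsVar x φ).Realize f ↔ ∃ b, φ.Realize (Function.update f x b) := by
  have key : ∀ i : Unit → A, (Sum.elim f i ∘ fun k : ℕ => if k = x then Sum.inr () else Sum.inl k) =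
      Function.update f x (i ()) := by
    intro i
    funext k
    by_cases hk : k = x <;> simp [hk]
  simp only [existsVar, Formula.realize_iExs, Formula.realize_relabel, key]
  exact ⟨fun ⟨i, hi⟩ => ⟨i (), hi⟩, fun ⟨b, hb⟩ => ⟨fun _ => b, hb⟩⟩

theorem realize_allClosure {A : Type*} [L.Structure A] [Nonempty A] {φ : L.Formula ℕ} :
    A ⊨ allClosure φ ↔ ∀ f : ℕ → A, φ.Realize f := by
  classical
  simp only [Sentence.Realize, allClosure, Formula.realize_iAlls, Formula.realize_relabel]
  constructor
  · intro h f
    exact (BoundedFormula.realize_restrictFreeVar (f := id)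
      (v := fun a : φ.freeVarFinset => f a) f fun a => rfl).1 (h fun a => f a)
  · intro h i
    let f : ℕ → A := fun n => if hn : n ∈ φ.freeVarFinset then i ⟨n, hn⟩ else
      Classical.arbitrary A
    exact (BoundedFormula.realize_restrictFreeVar f fun a => by simp [f]).2 (h f)

theorem nonempty_of_constants [Nonempty L.Constants] (A : Type*) [L.Structure A] : Nonempty A := by
  obtain ⟨c⟩ := ‹Nonempty L.Constants›
  exact ⟨Structure.funMap (L := L) (n := 0) c default⟩

variable [Nonempty L.Constants] {E : Set (Equation L ℕ)}

theorem model_theoryOf {A : Type (max u v)} [L.Structure A] :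
    A ⊨ theoryOf E ↔ InVariety E A := by
  constructor
  · intro h e he f
    have hmem : allClosure (Term.equal e.1 e.2) ∈ theoryOf E := fun B _ hB => by
      have := nonempty_of_constants (L := L) B
      rw [realize_allClosure]
      exact fun f => Formula.realize_equal.2 (hB e he f)
    have := nonempty_of_constants (L := L) A
    exact Formula.realize_equal.1 (realize_allClosure.1 (h.realize_of_mem _ hmem) f)
  · exact fun h => ⟨fun φ hφ => hφ A h⟩

variable (E) in
/-- An algebra of the variety in which every datum is solvable whenever its parameters satisfy the
condition `S`, `P`. -/
def IsClosedAlg (S : Datum L → Finset (Equation L ℕ))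
    (P : (j : Datum L) → Fin j.n → Finset (Equation L ℕ)) (A : Type*) [L.Structure A] : Prop :=
  InVariety E A ∧ ∀ (j : Datum L) (a : ℕ → A), Sat a (S j) (P j) →
    ∃ b, Sat (Function.update a j.x b) j.Γ j.Δ

variable {S : Datum L → Finset (Equation L ℕ)}
  {P : (j : Datum L) → Fin j.n → Finset (Equation L ℕ)}

theorem model_Tstar {A : Type (max u v)} [L.Structure A] :
    A ⊨ Tstar E S P ↔ IsClosedAlg E S P A := by
  have := nonempty_of_constants (L := L) A
  have hpsi : ∀ j, A ⊨ psi j (S j) (P j) ↔ ∀ a : ℕ → A, Sat a (S j) (P j) →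
      ∃ b, Sat (Function.update a j.x b) j.Γ j.Δ := by
    intro j
    rw [psi, realize_allClosure]
    simp only [Formula.realize_imp, realize_existsVar, realize_phi]
  rw [Tstar, Theory.model_union_iff, model_theoryOf, IsClosedAlg, Theory.model_iff]
  simp only [Set.forall_mem_range, hpsi]

end Axioms

/-! ### Quantifier elimination -/

section QuantifierElimination

variable {L : FirstOrder.Language.{u, v}}

/-- A finite set of equations to be satisfied, and a list of finite sets of equations each of
which is to be violated. -/
abbrev Clause (L : FirstOrder.Language.{u, v}) :=
  Finset (Equation L ℕ) × List (Finset (Equation L ℕ))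

/-- The datum of solving a clause for the variable `x`. -/
def Clause.datum (c : Clause L) (x : ℕ) : Datum L := ⟨c.1, c.2.length, c.2.get, x⟩

/-- The assignment `f` satisfies the clause. -/
def Clause.Sat {A : Type*} [L.Structure A] (f : ℕ → A) (c : Clause L) : Prop :=
  (∀ e ∈ c.1, Holds f e) ∧ ∀ D ∈ c.2, ¬ ∀ e ∈ D, Holds f e

theorem Clause.sat_datum {A : Type*} [L.Structure A] {f : ℕ → A} {c : Clause L} {x : ℕ} :
    UnifInterp.Sat f (c.datum x).Γ (c.datum x).Δ ↔ c.Sat f := by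
  refine and_congr_right fun _ => ?_
  constructor
  · intro h D hD
    obtain ⟨m, rfl⟩ := List.get_of_mem hD
    exact h m
  · exact fun h m => h _ (List.get_mem _ _)

/-- Disjunctive normal forms of a quantifier-free formula and of its negation. -/
theorem exists_disjunctive_normal_form [L.IsAlgebraic] {ψ : L.Formula ℕ} (hψ : ψ.IsQF) :
    ∃ l l' : List (Clause L), ∀ (A : Type w) [L.Structure A] (f : ℕ → A),
      (ψ.Realize f ↔ ∃ c ∈ l, c.Sat f) ∧ (¬ ψ.Realize f ↔ ∃ c ∈ l', c.Sat f) := by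
  classical
  induction hψ with
  | falsum =>
    refine ⟨[], [(∅, [])], fun A _ f => ⟨⟨fun h => h.elim, ?_⟩, ?_⟩⟩
    · rintro ⟨c, hc, -⟩
      simp at hc
    · exact ⟨fun _ => ⟨(∅, []), by simp, by simp [Clause.Sat]⟩, fun _ h => h⟩
  | of_isAtomic h =>
    cases h with
    | rel R ts => exact isEmptyElim R
    | equal t₁ t₂ =>
      let g : ℕ ⊕ Fin 0 → ℕ := Sum.elim id Fin.elim0
      let e : Equation L ℕ := (t₁.relabel g, t₂.relabel g)
      refine ⟨[({e}, [])], [(∅, [{e}])], fun A _ f => ?_⟩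
      have : (BoundedFormula.Realize (t₁.bdEqual t₂) f default) ↔ Holds f e := by
        have hg : f ∘ g = Sum.elim f (default : Fin 0 → A) := by
          funext i
          rcases i with i | i
          · rfl
          · exact i.elim0
        rw [BoundedFormula.realize_bdEqual]
        simp only [Holds, e, Term.realize_relabel, hg]
      constructor
      · refine this.trans ?_
        simp [Clause.Sat, e]
      · refine (not_congr this).trans ?_
        simp [Clause.Sat, e]
  | @imp φ χ hφ hχ ih₁ ih₂ =>
    obtain ⟨l₁, l₁', h₁⟩ := ih₁
    obtain ⟨l₂, l₂', h₂⟩ := ih₂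
    refine ⟨l₁' ++ l₂, (l₁ ×ˢ l₂').map fun c => (c.1.1 ∪ c.2.1, c.1.2 ++ c.2.2),
      fun A _ f => ⟨?_, ?_⟩⟩
    · rw [show Formula.Realize (φ.imp χ) f ↔ (Formula.Realize φ f → Formula.Realize χ f)
        from Iff.rfl, imp_iff_not_or, (h₁ A f).2, (h₂ A f).1]
      simp only [List.mem_append, or_and_right, exists_or]
    · rw [show Formula.Realize (φ.imp χ) f ↔ (Formula.Realize φ f → Formula.Realize χ f)
        from Iff.rfl, Classical.not_imp, (h₂ A f).2, (h₁ A f).1]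
      have hsat : ∀ c d : Clause L, Clause.Sat f ((c.1 ∪ d.1, c.2 ++ d.2) : Clause L) ↔
          c.Sat f ∧ d.Sat f := by
        intro c d
        simp only [Clause.Sat, Finset.mem_union, List.mem_append, or_imp, forall_and]
        tauto
      constructor
      · rintro ⟨⟨c, hc, hc'⟩, d, hd, hd'⟩
        exact ⟨_, List.mem_map.2 ⟨(c, d), List.mem_product.2 ⟨hc, hd⟩, rfl⟩,
          (hsat c d).2 ⟨hc', hd'⟩⟩
      · rintro ⟨_, hc, hs⟩
        obtain ⟨⟨c, d⟩, hcd, rfl⟩ := List.mem_map.1 hc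
        obtain ⟨hc, hd⟩ := List.mem_product.1 hcd
        exact ⟨⟨c, hc, ((hsat c d).1 hs).1⟩, d, hd, ((hsat c d).1 hs).2⟩

theorem isQF_subst {α β : Type*} {n : ℕ} {φ : L.BoundedFormula α n} (h : φ.IsQF)
    (g : α → L.Term β) : (φ.subst g).IsQF := by
  induction h with
  | falsum => exact BoundedFormula.isQF_bot
  | of_isAtomic h =>
    cases h with
    | equal t₁ t₂ => exact (BoundedFormula.IsAtomic.equal _ _).isQF
    | rel R ts => exact (BoundedFormula.IsAtomic.rel _ _).isQF
  | imp _ _ ih₁ ih₂ => exact ih₁.imp ih₂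

variable {E : Set (Equation L ℕ)} {S : Datum L → Finset (Equation L ℕ)}
  {P : (j : Datum L) → Fin j.n → Finset (Equation L ℕ)} [L.IsAlgebraic]

theorem exists_isQF_existsVar (hSP : ∀ j, EqInterpolants E j (S j) (P j)) {ψ : L.Formula ℕ}
    (hψ : ψ.IsQF) (x : ℕ) : ∃ χ : L.Formula ℕ, χ.IsQF ∧
      ∀ (A : Type (max u v)) [L.Structure A], IsClosedAlg E S P A → ∀ a : ℕ → A,
        (χ.Realize a ↔ ∃ b, ψ.Realize (Function.update a x b)) := by
  classical
  obtain ⟨l, l', hl⟩ := exists_disjunctive_normal_form.{u, v, max u v} hψ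
  refine ⟨(l.map fun c => phi (S (c.datum x)) (P (c.datum x))).foldr (· ⊔ ·) ⊥,
    isQF_foldr_sup fun φ hφ => ?_, fun A _ hA a => ?_⟩
  · obtain ⟨c, -, rfl⟩ := List.mem_map.1 hφ
    exact isQF_phi _ _
  · have hc : ∀ c : Clause L, Sat a (S (c.datum x)) (P (c.datum x)) ↔
        ∃ b, c.Sat (Function.update a x b) := by
      intro c
      constructor
      · intro h
        obtain ⟨b, hb⟩ := hA.2 _ a h
        exact ⟨b, Clause.sat_datum.1 hb⟩
      · rintro ⟨b, hb⟩
        have := (hSP (c.datum x)).sat_params hA.1 (Clause.sat_datum.2 hb)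
        refine (sat_congr (hSP _).vars_left (hSP _).vars_right fun n hn => ?_).1 this
        exact Function.update_of_ne (Finset.ne_of_mem_erase hn) _ _
    rw [Formula.Realize, BoundedFormula.realize_foldr_sup]
    simp only [(hl A _).1, List.mem_map, exists_exists_and_eq_and]
    constructor
    · rintro ⟨c, hcl, h⟩
      obtain ⟨b, hb⟩ := (hc c).1 (realize_phi.1 h)
      exact ⟨b, c, hcl, hb⟩
    · rintro ⟨b, c, hcl, hb⟩
      exact ⟨c, hcl, realize_phi.2 ((hc c).2 ⟨b, hb⟩)⟩

/-- Over closed algebras a formula in the free variables `0, …, n - 1` and the bound variables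
`n, …, n + k - 1` is equivalent to a quantifier-free formula. -/
theorem exists_isQF_realize_iff (hSP : ∀ j, EqInterpolants E j (S j) (P j)) {n k : ℕ}
    (φ : L.BoundedFormula (Fin n) k) : ∃ ψ : L.Formula ℕ, ψ.IsQF ∧
      ∀ (A : Type (max u v)) [L.Structure A], IsClosedAlg E S P A →
        ∀ (f : Fin n → A) (xs : Fin k → A) (a : ℕ → A), (∀ i : Fin n, a i = f i) →
          (∀ i : Fin k, a (n + i) = xs i) → (φ.Realize f xs ↔ ψ.Realize a) := by
  induction φ with
  | falsum => exact ⟨⊥, BoundedFormula.isQF_bot, fun _ _ _ _ _ _ _ _ => Iff.rfl⟩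
  | @equal k t₁ t₂ =>
    let g : Fin n ⊕ Fin k → ℕ := Sum.elim (fun i => i) fun i => n + i
    refine ⟨Term.equal (t₁.relabel g) (t₂.relabel g), (BoundedFormula.IsAtomic.equal _ _).isQF,
      fun A _ _ f xs a hf hxs => ?_⟩
    have hg : a ∘ g = Sum.elim f xs := by
      funext i
      rcases i with i | i
      · exact hf i
      · exact hxs i
    rw [Formula.realize_equal, Term.realize_relabel, Term.realize_relabel, hg]
    rfl
  | rel R ts => exact isEmptyElim R
  | imp φ χ ih₁ ih₂ =>
    obtain ⟨ψ₁, h₁, h₁'⟩ := ih₁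
    obtain ⟨ψ₂, h₂, h₂'⟩ := ih₂
    refine ⟨ψ₁.imp ψ₂, h₁.imp h₂, fun A _ hA f xs a hf hxs => ?_⟩
    rw [BoundedFormula.realize_imp, Formula.realize_imp, h₁' A hA f xs a hf hxs,
      h₂' A hA f xs a hf hxs]
  | @all k φ ih =>
    obtain ⟨ψ, hψ, h⟩ := ih
    obtain ⟨χ, hχ, h'⟩ := exists_isQF_existsVar hSP hψ.not (n + k)
    refine ⟨χ.not, hχ.not, fun A _ hA f xs a hf hxs => ?_⟩
    rw [Formula.realize_not, h' A hA a, BoundedFormula.realize_all, not_exists]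
    refine forall_congr' fun b => ?_
    change _ ↔ ¬ ¬ _
    rw [not_not]
    refine h A hA f _ _ (fun i => ?_) fun i => ?_
    · rw [Function.update_of_ne (by omega), hf]
    · refine Fin.lastCases ?_ (fun i => ?_) i
      · simp
      · rw [Function.update_of_ne (by simp; omega), Fin.snoc_castSucc]
        exact hxs i

theorem quantifierElimination_Tstar [Nonempty L.Constants]
    (hSP : ∀ j, EqInterpolants E j (S j) (P j)) : QuantifierElimination (Tstar E S P) := by
  intro n φ
  obtain ⟨ψ, hψ, h⟩ := exists_isQF_realize_iff hSP φ
  obtain ⟨c⟩ := ‹Nonempty L.Constants›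
  -- The variables other than `0, …, n - 1` are irrelevant and are replaced by a constant.
  let g : ℕ → L.Term (Fin n) := fun k => if hk : k < n then Term.var ⟨k, hk⟩ else c.term
  refine ⟨ψ.subst g, isQF_subst hψ g, ?_⟩
  rw [Theory.Iff, Theory.models_formula_iff]
  intro M f
  have hM : IsClosedAlg E S P M := model_Tstar.1 M.is_model
  rw [Formula.realize_iff]
  refine (h M hM f default _ (fun i => ?_) fun i => i.elim0).trans
    (BoundedFormula.realize_subst (φ := ψ) (tf := g)).symm
  simp [g]

end QuantifierElimination

/-! ### The model completion -/

section ModelCompletion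

variable {L : FirstOrder.Language.{u, v}} [L.IsAlgebraic] [Nonempty L.Constants]
  {E : Set (Equation L ℕ)} {S : Datum L → Finset (Equation L ℕ)}
  {P : (j : Datum L) → Fin j.n → Finset (Equation L ℕ)}

theorem coTheories_Tstar (hAP : AmalgamationProperty E) (hLeft : LeftUniformInterpolation E)
    (hRes : HasEqResiduals E) (hSP : ∀ j, EqInterpolants E j (S j) (P j)) :
    CoTheories (theoryOf E) (Tstar E S P) := by
  intro φ hφ
  constructor
  · intro h M f xs
    have hM : (M : Type (max u v)) ⊨ theoryOf E := model_theoryOf.2 (model_Tstar.1 M.is_model).1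
    exact h (Theory.ModelType.of (theoryOf E) M) f xs
  · intro h M f xs
    obtain ⟨N, _, hN, ⟨i⟩, hcl⟩ :=
      exists_extension_closed hAP hLeft hRes hSP (model_theoryOf.1 M.is_model)
    have hN' : N ⊨ Tstar E S P := model_Tstar.2 ⟨hN, hcl⟩
    have := nonempty_of_constants (L := L) N
    exact hφ.realize_embedding i (h (Theory.ModelType.of (Tstar E S P) N) (i ∘ f) (i ∘ xs))

/-- An embedding of `L`-structures preserves the names of the elements of its domain. -/
def embeddingWithConstants {M N : Type*} [L.Structure M] [L.Structure N] (i : M ↪[L] N) :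
    letI := constantsOn.structure (i : M → N)
    M ↪[L[[M]]] N :=
  letI := constantsOn.structure (i : M → N)
  { toFun := i
    inj' := i.injective
    map_fun' := by
      rintro n (F | F) x
      · exact i.map_fun F x
      · cases n with
        | zero => rfl
        | succ n => exact isEmptyElim F
    map_rel' := by
      rintro n (R | R) x
      · exact isEmptyElim R
      · exact isEmptyElim R }

theorem isQF_of_mem_diagram {L : FirstOrder.Language.{u, v}} {M : Type*} [L.Structure M]
    {φ : L[[M]].Sentence} (h : φ ∈ diagram M) : φ.IsQF := by
  rcases h with ⟨h | ⟨χ, h, rfl⟩, -⟩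
  · exact h.isQF
  · exact h.isQF.not

/-- The sentence expressing that the elements `m` and `m'` are equal. -/
def eqSentence (L : FirstOrder.Language.{u, v}) {M : Type*} (m m' : M) : L[[M]].Sentence :=
  Term.equal (L.con m).term (L.con m').term

theorem realize_eqSentence {L : FirstOrder.Language.{u, v}} {M N : Type*} [L[[M]].Structure N]
    {m m' : M} : N ⊨ eqSentence L m m' ↔ (L.con m : N) = (L.con m' : N) := by
  refine Formula.realize_equal.trans ?_
  rw [Term.realize_constants, Term.realize_constants]

/-- The sentence expressing that `m` is the value of the operation `F` at `x`. -/
def valueSentence {L : FirstOrder.Language.{u, v}} {M : Type*} {n : ℕ} (F : L.Functions n)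
    (x : Fin n → M) (m : M) : L[[M]].Sentence :=
  Term.equal (L.con m).term
    (Term.func (Sum.inl F : L[[M]].Functions n) fun i => (L.con (x i)).term)

theorem realize_valueSentence {L : FirstOrder.Language.{u, v}} {M N : Type*} [L.Structure N]
    [L[[M]].Structure N] [(L.lhomWithConstants M).IsExpansionOn N] {n : ℕ} {F : L.Functions n}
    {x : Fin n → M} {m : M} :
    N ⊨ valueSentence F x m ↔ (L.con m : N) = Structure.funMap F fun i => (L.con (x i) : N) := by
  refine Formula.realize_equal.trans ?_
  rw [Term.realize_constants]
  refine iff_of_eq (congrArg _ ((withConstants_funMap_sumInl (L := L) (α := M)).trans ?_))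
  exact congrArg _ (funext fun i => Term.realize_constants)

/-- A model of the diagram of `M` is an extension of `M`. -/
theorem exists_embedding_of_models_diagram {L : FirstOrder.Language.{u, v}} [L.IsAlgebraic]
    {M K : Type*} [L.Structure M] [L.Structure K] [L[[M]].Structure K]
    [(L.lhomWithConstants M).IsExpansionOn K] (hK : K ⊨ diagram (L := L) M) :
    ∃ i : M ↪[L] K, ∀ m, i m = (L.con m : K) := by
  let h : M →[L] K :=
    { toFun := fun m => (L.con m : K)
      map_fun' := fun F x => realize_valueSentence.1 (hK.realize_of_mem
        (valueSentence F x (Structure.funMap F x))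
        ⟨Or.inl (BoundedFormula.IsAtomic.equal _ _), realize_valueSentence.2 rfl⟩)
      map_rel' := fun R => isEmptyElim R }
  refine ⟨embeddingOfInjective h fun m m' hm => ?_, fun m => rfl⟩
  by_contra hne
  have := hK.realize_of_mem (eqSentence L m m').not
    ⟨Or.inr ⟨_, BoundedFormula.IsAtomic.equal _ _, rfl⟩,
      (Sentence.realize_not M).2 fun h => hne (realize_eqSentence.1 h)⟩
  exact (Sentence.realize_not K).1 this (realize_eqSentence.2 hm)

/-- A theory with quantifier elimination decides every sentence over a diagram: the sentence
amounts to a quantifier-free one, whose truth is settled by the diagram. -/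
theorem QuantifierElimination.exists_iff {T : L.Theory} (hT : QuantifierElimination T)
    {M : Type (max u v)} [L.Structure M] (φ : L[[M]].Sentence) :
    ∃ p : Prop, ∀ (K : Type (max u v)) [L[[M]].Structure K],
      K ⊨ (L.lhomWithConstants M).onTheory T ∪ diagram M → (K ⊨ φ ↔ p) := by
  classical
  let χ : L.Formula M := Formula.equivSentence.symm φ
  let e := χ.freeVarFinset.equivFin
  let χ' : L.Formula (Fin χ.freeVarFinset.card) := χ.restrictFreeVar e
  obtain ⟨ψ, hψ, hχψ⟩ := hT _ χ'
  let m : Fin χ.freeVarFinset.card → M := fun i => e.symm i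
  refine ⟨ψ.Realize m, fun K _ hK => ?_⟩
  let _ : L.Structure K := (L.lhomWithConstants M).reduct K
  rw [Theory.model_union_iff, LHom.onTheory_model] at hK
  obtain ⟨hKT, hKM⟩ := hK
  have : Nonempty K := nonempty_of_constants (L := L) K
  obtain ⟨i, hi⟩ := exists_embedding_of_models_diagram hKM
  have h₁ : K ⊨ φ ↔ χ.Realize fun a => (L.con a : K) :=
    (Formula.realize_equivSentence_symm_con K φ).symm
  have h₂ : χ.Realize (fun a => (L.con a : K)) ↔ χ'.Realize (i ∘ m) :=
    (BoundedFormula.realize_restrictFreeVar (φ := χ) (f := e) (v := i ∘ m)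
      (fun a => (L.con a : K)) fun a => by simp [m, hi]).symm
  have h₃ : χ'.Realize (i ∘ m) ↔ ψ.Realize (i ∘ m) :=
    hχψ.realize_iff (M := K)
  rw [h₁, h₂, h₃, Formula.Realize, Formula.Realize, ← hψ.realize_embedding i]
  exact iff_of_eq (congrArg _ (Subsingleton.elim _ _))

theorem isComplete_Tstar_union_diagram (hAP : AmalgamationProperty E)
    (hLeft : LeftUniformInterpolation E) (hRes : HasEqResiduals E)
    (hSP : ∀ j, EqInterpolants E j (S j) (P j)) (M : Type (max u v)) [L.Structure M]
    (hM : M ⊨ theoryOf E) :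
    ((L.lhomWithConstants M).onTheory (Tstar E S P) ∪ diagram M).IsComplete := by
  constructor
  · obtain ⟨N, _, hN, ⟨i⟩, hcl⟩ :=
      exists_extension_closed hAP hLeft hRes hSP (model_theoryOf.1 hM)
    let _ := constantsOn.structure (i : M → N)
    have := nonempty_of_constants (L := L) N
    have hN' : N ⊨ (L.lhomWithConstants M).onTheory (Tstar E S P) :=
      (LHom.onTheory_model _ _).2 (model_Tstar.2 ⟨hN, hcl⟩)
    have hdiag : N ⊨ diagram (L := L) M := ⟨fun φ hφ => by
      have := (isQF_of_mem_diagram hφ).realize_embedding (embeddingWithConstants i)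
        (v := default) (xs := default)
      rw [Subsingleton.elim (embeddingWithConstants i ∘ default) default,
        Subsingleton.elim (embeddingWithConstants i ∘ default) default] at this
      exact this.2 hφ.2⟩
    have hU := Theory.model_union_iff.2 ⟨hN', hdiag⟩
    exact ⟨Theory.ModelType.of _ N⟩
  · intro φ
    obtain ⟨p, hp⟩ := (quantifierElimination_Tstar hSP).exists_iff φ
    by_cases h : p
    · exact Or.inl (Theory.models_sentence_iff.2 fun K => (hp K K.is_model).2 h)
    · exact Or.inr (Theory.models_sentence_iff.2 fun K => by
        rw [Sentence.realize_not]
        exact fun hK => h ((hp K K.is_model).1 hK))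

theorem isModelCompletion_Tstar (hAP : AmalgamationProperty E) (hLeft : LeftUniformInterpolation E)
    (hRes : HasEqResiduals E) (hSP : ∀ j, EqInterpolants E j (S j) (P j)) :
    IsModelCompletion (theoryOf E) (Tstar E S P) := by
  refine ⟨⟨coTheories_Tstar hAP hLeft hRes hSP, fun n φ => ?_⟩, fun M _ _ hM =>
    isComplete_Tstar_union_diagram hAP hLeft hRes hSP M hM⟩
  obtain ⟨ψ, hψ, h⟩ := quantifierElimination_Tstar hSP n φ
  exact ⟨ψ, hψ.isExistential, h⟩

end ModelCompletion

end

end UnifInterp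

theorem theorem5p2 {L : FirstOrder.Language.{u, v}} [L.IsAlgebraic] [Nonempty L.Constants]
    (E : Set (UnifInterp.Equation L ℕ))
    (hAP : UnifInterp.AmalgamationProperty E)
    (hLeft : UnifInterp.LeftUniformInterpolation E)
    (hRight : UnifInterp.RightUniformInterpolation E)
    (hBr : ∀ (A : Type (max u v)) [L.Structure A], UnifInterp.InVariety E A →
      UnifInterp.FinitelyPresented E A → UnifInterp.DuallyBrouwerian (UnifInterp.KCon L A)) :
    (∃ T' : L.Theory, UnifInterp.IsModelCompletion (UnifInterp.theoryOf E) T') ∧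
    (∃ (S : UnifInterp.Datum L → Finset (UnifInterp.Equation L ℕ))
        (P : (j : UnifInterp.Datum L) → Fin j.n → Finset (UnifInterp.Equation L ℕ)),
        ∀ j, UnifInterp.Interpolants E j (S j) (P j)) ∧
    ∀ (S : UnifInterp.Datum L → Finset (UnifInterp.Equation L ℕ))
      (P : (j : UnifInterp.Datum L) → Fin j.n → Finset (UnifInterp.Equation L ℕ)),
      (∀ j, UnifInterp.Interpolants E j (S j) (P j)) →
        UnifInterp.IsModelCompletion (UnifInterp.theoryOf E) (UnifInterp.Tstar E S P) ∧
        UnifInterp.QuantifierElimination (UnifInterp.Tstar E S P) ∧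
        UnifInterp.CoTheories (UnifInterp.theoryOf E) (UnifInterp.Tstar E S P) := by
  have hB := UnifInterp.duallyBrouwerian_freeAlg hBr
  have hRes := UnifInterp.hasEqResiduals hB
  choose S P hSP using UnifInterp.exists_eqInterpolants hLeft hRight hRes
  refine ⟨⟨_, UnifInterp.isModelCompletion_Tstar hAP hLeft hRes hSP⟩,
    ⟨S, P, fun j => (hSP j).interpolants hB⟩, fun S' P' h => ?_⟩
  have hSP' := fun j => (h j).eqInterpolants
  exact ⟨UnifInterp.isModelCompletion_Tstar hAP hLeft hRes hSP',
    UnifInterp.quantifierElimination_Tstar hSP',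
    UnifInterp.coTheories_Tstar hAP hLeft hRes hSP'⟩
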